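/- Let $B=\{x\in\mathbb R^2:|x|<1\}$, let $g\in L^q(B)$ for some $q>2$ be radial with $g>0$ a.e. in $B$, and let $\sigma\in(-1,1]$ and $p\in(0,1)\cup(1,\infty)$. Let $u\in H^2(B)\cap H^1_0(B)$ be a weak solution of the Steklov problem $$\Delta^2u=g(x)|u|^{p-1}u\ \text{ in }B,\qquad u=\Delta u-(1-\sigma)u_n=0\ \text{ on }\partial B,$$ where $u_n$ is the exterior normal derivative, that is, $$\int_B\Delta u\,\Delta\varphi\,dx-(1-\sigma)\int_{\partial B}u_n\varphi_n\,ds=\int_B g\,|u|^{p-1}u\,\varphi\,dx\qquad\text{for all }\varphi\in H^2(B)\cap H^1_0(B).$$ If $u$ is radial, $u\ge 0$ a.e. in $B$ and $u$ is not a.e. equal to $0$, then $u$ is strictly radially decreasing, hence positive in $B$: there is a continuous strictly decreasing function $U:[0,1]\to\mathbb R$ with $U>0$ on $[0,1)$ such that $u(x)=U(|x|)$ for a.e. $x\in B$. -/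

import Mathlib

open MeasureTheory Filter Topology
open scoped ContDiff ENNReal

/-- The Euclidean plane. -/
abbrev Plane : Type := EuclideanSpace ℝ (Fin 2)

/-- The open unit disk `B` of the plane, centred at the origin. -/
abbrev unitDisk : Set Plane := Metric.ball (0 : Plane) 1

/-- Lebesgue measure on the unit disk. -/
noncomputable abbrev diskMeasure : Measure Plane := volume.restrict unitDisk

/-- Arc length on the unit circle. -/
noncomputable abbrev circleMeasure : Measure (Metric.sphere (0 : Plane) 1) :=
  (volume : Measure Plane).toSphere

/-- The classical partial derivative `∂ᵢ φ`. -/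
noncomputable def partialDeriv (i : Fin 2) (φ : Plane → ℝ) (x : Plane) : ℝ :=
  fderiv ℝ φ x (EuclideanSpace.single i 1)

/-- `φ` belongs to `C_c^∞(B)`. -/
structure IsDiskTestFunction (φ : Plane → ℝ) : Prop where
  smooth : ContDiff ℝ ∞ φ
  compact : HasCompactSupport φ
  support_subset : tsupport φ ⊆ unitDisk

/-- `v` is the weak partial derivative `∂ᵢ u` in the disk (used only for `u`, `v` in `L²(B)`). -/
def HasWeakPartial (i : Fin 2) (u v : Plane → ℝ) : Prop :=
  ∀ φ : Plane → ℝ, IsDiskTestFunction φ →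
    ∫ x in unitDisk, u x * partialDeriv i φ x = - ∫ x in unitDisk, v x * φ x

/-- `u` belongs to `H²(B)`, with first weak derivatives `D i` and second weak derivatives
`D2 i j = ∂ⱼ ∂ᵢ u`. All these functions matter only up to null sets of the disk. -/
structure HasH2Derivs (u : Plane → ℝ) (D : Fin 2 → Plane → ℝ)
    (D2 : Fin 2 → Fin 2 → Plane → ℝ) : Prop where
  memLp : MemLp u 2 diskMeasure
  memLp_first : ∀ i, MemLp (D i) 2 diskMeasure
  memLp_second : ∀ i j, MemLp (D2 i j) 2 diskMeasure
  first : ∀ i, HasWeakPartial i u (D i)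
  second : ∀ i j, HasWeakPartial j (D i) (D2 i j)

/-- `u`, with weak gradient `D`, belongs to `H¹₀(B)`, the closure of `C_c^∞(B)` in the norm
of `H¹(B)`. -/
def IsH10 (u : Plane → ℝ) (D : Fin 2 → Plane → ℝ) : Prop :=
  ∃ φ : ℕ → Plane → ℝ, (∀ k, IsDiskTestFunction (φ k)) ∧
    Tendsto (fun k => eLpNorm (fun x => u x - φ k x) 2 diskMeasure) atTop (𝓝 0) ∧
    ∀ i, Tendsto (fun k => eLpNorm (fun x => D i x - partialDeriv i (φ k) x) 2 diskMeasure)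
      atTop (𝓝 0)

/-- The weak Laplacian, from the second weak derivatives. -/
def weakLaplacian (D2 : Fin 2 → Fin 2 → Plane → ℝ) (x : Plane) : ℝ := ∑ i, D2 i i x

/-- `γ ∈ L²(∂B)` is the exterior normal derivative (in the trace sense) of the `H²(B)` function
with first derivatives `D` and second derivatives `D2`:
`∫_B (∇u · ∇ψ + Δu ψ) = ∫_{∂B} γ ψ` for every `ψ` smooth up to the boundary.
By the trace theorem and the divergence theorem such a `γ` exists for every function of `H²(B)`
and is the trace of `∇u · n`; by density of the restrictions of the `ψ` in `L²(∂B)` it is unique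
up to null sets. -/
structure IsNormalDeriv (D : Fin 2 → Plane → ℝ) (D2 : Fin 2 → Fin 2 → Plane → ℝ)
    (γ : Metric.sphere (0 : Plane) 1 → ℝ) : Prop where
  memLp : MemLp γ 2 circleMeasure
  green : ∀ ψ : Plane → ℝ, ContDiff ℝ ∞ ψ →
    ∫ x in unitDisk, ((∑ i, D i x * partialDeriv i ψ x) + weakLaplacian D2 x * ψ x) =
      ∫ z, γ z * ψ (z : Plane) ∂circleMeasure

/-- `u ∈ H²(B) ∩ H¹₀(B)` is a weak solution of the Steklov problem
`Δ²u = g |u|^(p-1) u` in `B`, `u = Δu - (1 - σ) u_n = 0` on `∂B`, that is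
`∫_B Δu Δφ - (1 - σ) ∫_{∂B} u_n φ_n = ∫_B g |u|^(p-1) u φ` for all `φ ∈ H²(B) ∩ H¹₀(B)`. -/
def IsWeakSteklovSolution (σ p : ℝ) (g u : Plane → ℝ) : Prop :=
  ∃ (D : Fin 2 → Plane → ℝ) (D2 : Fin 2 → Fin 2 → Plane → ℝ)
    (γ : Metric.sphere (0 : Plane) 1 → ℝ),
    HasH2Derivs u D D2 ∧ IsH10 u D ∧ IsNormalDeriv D D2 γ ∧
    ∀ (φ : Plane → ℝ) (E : Fin 2 → Plane → ℝ) (E2 : Fin 2 → Fin 2 → Plane → ℝ)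
      (η : Metric.sphere (0 : Plane) 1 → ℝ),
      HasH2Derivs φ E E2 → IsH10 φ E → IsNormalDeriv E E2 η →
      (∫ x in unitDisk, weakLaplacian D2 x * weakLaplacian E2 x)
          - (1 - σ) * ∫ z, γ z * η z ∂circleMeasure
        = ∫ x in unitDisk, g x * |u x| ^ (p - 1) * u x * φ x

/-- `f` is (almost everywhere in the disk) a function of `|x|` alone. -/
def IsRadialOnDisk (f : Plane → ℝ) : Prop :=
  ∃ F : ℝ → ℝ, ∀ᵐ x ∂diskMeasure, f x = F ‖x‖

/-! Everything is expressed in `s = |x|²`, under which Lebesgue measure on the disk becomes `π ds`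
on `(0,1]`. Let `M(τ)` be the integral of `Δu` over `{|x|² < τ}`. For radial `u` the divergence
theorem gives `4πτ U'(τ) = M(τ)` for the profile `U` in the variable `s`. Since `u = 0` on the
circle, `u(x) = ∫ A` over `(|x|², 1)` with `A = -M/(4πτ)`. It therefore suffices to show `M < 0` on
`(0,1)`.

The representation of `u` is `ae_eq_radialPotential_profileDensity`. It is obtained by duality,
pairing `u` with Laplacians of smooth radial functions; no regularity theory and no one-dimensional
Sobolev calculus is needed.

The sign of `M` comes in two stages. Nonnegativity of `u` with zero boundary values forces `M(1) ≤
0` (`diskCumulative_one_nonpos`), the integrated form of `u_n ≤ 0`. For `t < 1`, the weak equation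
is tested with the radial `φ` solving `-Δφ = ρ`, `φ = 0` on the circle, where `ρ` is a smooth
approximation of the indicator of `s ≤ t`. Then `φ > 0` in the disk and `φ_n ≤ 0`, so `∫ Δu ρ =
-(1-σ)|φ_n| |M(1)| - ∫ g|u|^(p-1)u φ`, which is negative uniformly in the approximation. The limit
gives `M(t) < 0` (`diskCumulative_neg`). -/

/-! ### Smooth radial potentials and their derivatives -/

theorem contDiff_primitive {a : ℝ → ℝ} (ha : ContDiff ℝ ∞ a) (c : ℝ) :
    ContDiff ℝ ∞ (fun s => ∫ τ in c..s, a τ) := by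
  have h : ∀ s, HasDerivAt (fun s => ∫ τ in c..s, a τ) (a s) s := fun s =>
    intervalIntegral.integral_hasDerivAt_right (ha.continuous.intervalIntegrable _ _)
      (ha.continuous.stronglyMeasurableAtFilter _ _) ha.continuous.continuousAt
  rw [contDiff_infty_iff_deriv]
  refine ⟨fun s => (h s).differentiableAt, ?_⟩
  rwa [show deriv (fun s => ∫ τ in c..s, a τ) = a from funext fun s => (h s).deriv]

/-- The radial function vanishing on the unit circle with gradient `-2 a(|x|²) x`. -/
noncomputable def radialPotential (a : ℝ → ℝ) (x : Plane) : ℝ := ∫ τ in (‖x‖ ^ 2)..1, a τ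

theorem radialPotential_contDiff {a : ℝ → ℝ} (ha : ContDiff ℝ ∞ a) :
    ContDiff ℝ ∞ (radialPotential a) := by
  have h : radialPotential a = fun x => -((fun s => ∫ τ in (1 : ℝ)..s, a τ) (‖x‖ ^ 2)) := by
    funext x
    rw [radialPotential, intervalIntegral.integral_symm]
  rw [h]
  exact ((contDiff_primitive ha 1).comp (contDiff_norm_sq ℝ)).neg

theorem hasFDerivAt_norm_sq_plane (x : Plane) :
    HasFDerivAt (fun x : Plane => ‖x‖ ^ 2) (2 • innerSL ℝ x) x :=
  (hasStrictFDerivAt_norm_sq x).hasFDerivAt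

theorem partialDeriv_comp_norm_sq {f : ℝ → ℝ} {x : Plane} {f' : ℝ}
    (hf : HasDerivAt f f' (‖x‖ ^ 2)) (i : Fin 2) :
    partialDeriv i (fun x => f (‖x‖ ^ 2)) x = f' * (2 * x i) := by
  have h : HasFDerivAt (fun x : Plane => f (‖x‖ ^ 2)) (f' • (2 • innerSL ℝ x)) x :=
    hf.comp_hasFDerivAt x (hasFDerivAt_norm_sq_plane x)
  rw [partialDeriv, h.fderiv]
  simp [EuclideanSpace.inner_single_right]

theorem partialDeriv_radialPotential {a : ℝ → ℝ} (ha : Continuous a) (i : Fin 2) :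
    partialDeriv i (radialPotential a) = fun x => -2 * a (‖x‖ ^ 2) * x i := by
  funext x
  have h := intervalIntegral.integral_hasDerivAt_left (ha.intervalIntegrable (‖x‖ ^ 2) 1)
      (ha.stronglyMeasurableAtFilter _ _) ha.continuousAt
  refine (partialDeriv_comp_norm_sq h i).trans ?_
  ring

theorem partialDeriv_mul {f g : Plane → ℝ} {x : Plane} (hf : DifferentiableAt ℝ f x)
    (hg : DifferentiableAt ℝ g x) (i : Fin 2) :
    partialDeriv i (fun x => f x * g x) x = f x * partialDeriv i g x + partialDeriv i f x * g x := by
  simp only [partialDeriv]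
  rw [fderiv_fun_mul hf hg]
  simp [mul_comm]

theorem partialDeriv_apply_self (i : Fin 2) (x : Plane) :
    partialDeriv i (fun x : Plane => x i) x = 1 := by
  have h : HasFDerivAt (fun x : Plane => x i) (EuclideanSpace.proj i : Plane →L[ℝ] ℝ) x :=
    (EuclideanSpace.proj i : Plane →L[ℝ] ℝ).hasFDerivAt
  rw [partialDeriv, h.fderiv]
  simp

theorem partialDeriv_contDiff {φ : Plane → ℝ} (hφ : ContDiff ℝ ∞ φ) (i : Fin 2) :
    ContDiff ℝ ∞ (partialDeriv i φ) :=
  (hφ.fderiv_right (m := ∞) le_rfl).clm_apply contDiff_const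

theorem weakLaplacian_radialPotential {a : ℝ → ℝ} (ha : ContDiff ℝ ∞ a) (x : Plane) :
    weakLaplacian (fun i j => partialDeriv j (partialDeriv i (radialPotential a))) x
      = -(4 * a (‖x‖ ^ 2) + 4 * ‖x‖ ^ 2 * deriv a (‖x‖ ^ 2)) := by
  have hda : ∀ s, HasDerivAt a (deriv a s) s := fun s =>
    ((ha.differentiable (by simp)) s).hasDerivAt
  have hdiff : DifferentiableAt ℝ (fun x : Plane => a (‖x‖ ^ 2)) x :=
    ((hda _).comp_hasFDerivAt x (hasFDerivAt_norm_sq_plane x)).differentiableAt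
  have h2 : ∀ i, partialDeriv i (partialDeriv i (radialPotential a)) x
      = -2 * a (‖x‖ ^ 2) + (-4) * deriv a (‖x‖ ^ 2) * x i ^ 2 := fun i => by
    rw [partialDeriv_radialPotential ha.continuous,
      partialDeriv_mul (hdiff.const_mul (-2))
        (g := fun x => x i) (EuclideanSpace.proj i : Plane →L[ℝ] ℝ).differentiableAt,
      partialDeriv_apply_self,
      partialDeriv_comp_norm_sq (f := fun s => -2 * a s) ((hda _).const_mul (-2))]
    ring
  rw [weakLaplacian, Fin.sum_univ_two, h2, h2, EuclideanSpace.norm_sq_eq,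
    Fin.sum_univ_two, Real.norm_eq_abs, Real.norm_eq_abs, sq_abs, sq_abs]
  ring

/-- The Laplacian of the potential is `-(4 s a)'` at `s = |x|²`. Solving `-Δφ = ρ` with zero
boundary values thus amounts to choosing `a` as a radial average of `ρ`. -/
theorem weakLaplacian_radialPotential_of_integral {a ρ : ℝ → ℝ} (ha : ContDiff ℝ ∞ a)
    (hρ : Continuous ρ) (h : ∀ s, 4 * s * a s = ∫ τ in (0 : ℝ)..s, ρ τ) (x : Plane) :
    weakLaplacian (fun i j => partialDeriv j (partialDeriv i (radialPotential a))) x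
      = -ρ (‖x‖ ^ 2) := by
  rw [weakLaplacian_radialPotential ha, neg_inj]
  generalize ‖x‖ ^ 2 = s
  have h1 : HasDerivAt (fun s => 4 * s * a s) (4 * a s + 4 * s * deriv a s) s := by
    have := ((hasDerivAt_id s).const_mul 4).mul ((ha.differentiable (by simp)) s).hasDerivAt
    simp only [id, mul_one] at this
    exact this
  have h2 : HasDerivAt (fun s => ∫ τ in (0 : ℝ)..s, ρ τ) (ρ s) s :=
    intervalIntegral.integral_hasDerivAt_right (hρ.intervalIntegrable _ _)
      (hρ.stronglyMeasurableAtFilter _ _) hρ.continuousAt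
  rw [← funext h] at h2
  exact h1.unique h2

/-! ### Radial potentials belong to H² ∩ H¹₀ -/

instance : IsFiniteMeasure diskMeasure :=
  ⟨by rw [Measure.restrict_apply_univ]; exact measure_ball_lt_top⟩

theorem memLp_disk_of_continuous {f : Plane → ℝ} (hf : Continuous f) (q : ℝ≥0∞) :
    MemLp f q diskMeasure := by
  obtain ⟨C, hC⟩ := (isCompact_closedBall (0 : Plane) 1).exists_bound_of_continuousOn
    hf.continuousOn
  refine MemLp.of_bound hf.aestronglyMeasurable C ?_
  filter_upwards [ae_restrict_mem Metric.isOpen_ball.measurableSet] with x hx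
  exact hC x (Metric.ball_subset_closedBall hx)

theorem setIntegral_disk_of_tsupport {f : Plane → ℝ} (hf : tsupport f ⊆ unitDisk) :
    ∫ x in unitDisk, f x = ∫ x, f x :=
  setIntegral_eq_integral_of_forall_compl_eq_zero fun _ hx =>
    image_eq_zero_of_notMem_tsupport fun h => hx (hf h)

theorem hasWeakPartial_of_contDiff {φ : Plane → ℝ} (hφ : ContDiff ℝ ∞ φ) (i : Fin 2) :
    HasWeakPartial i φ (partialDeriv i φ) := by
  intro θ hθ
  have hθd : ContDiff ℝ ∞ (partialDeriv i θ) := partialDeriv_contDiff hθ.smooth i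
  have hφd : ContDiff ℝ ∞ (partialDeriv i φ) := partialDeriv_contDiff hφ i
  have hsub : tsupport (partialDeriv i θ) ⊆ tsupport θ :=
    tsupport_fderiv_apply_subset ℝ (EuclideanSpace.single i 1)
  have hcd : HasCompactSupport (partialDeriv i θ) := hθ.compact.of_isClosed_subset
    (isClosed_tsupport _) hsub
  rw [setIntegral_disk_of_tsupport, setIntegral_disk_of_tsupport]
  · refine integral_mul_fderiv_eq_neg_fderiv_mul_of_integrable ?_ ?_ ?_ ?_ ?_
    · exact (hφd.continuous.mul hθ.smooth.continuous).integrable_of_hasCompactSupport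
        hθ.compact.mul_left
    · exact (hφ.continuous.mul hθd.continuous).integrable_of_hasCompactSupport hcd.mul_left
    · exact (hφ.continuous.mul hθ.smooth.continuous).integrable_of_hasCompactSupport
        hθ.compact.mul_left
    · exact fun x _ => hφ.differentiable (by simp) x
    · exact fun x _ => hθ.smooth.differentiable (by simp) x
  · exact (tsupport_mul_subset_right).trans hθ.support_subset
  · exact (tsupport_mul_subset_right).trans (hsub.trans hθ.support_subset)

theorem hasH2Derivs_of_contDiff {φ : Plane → ℝ} (hφ : ContDiff ℝ ∞ φ) :
    HasH2Derivs φ (fun i => partialDeriv i φ)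
      (fun i j => partialDeriv j (partialDeriv i φ)) where
  memLp := memLp_disk_of_continuous hφ.continuous 2
  memLp_first i := memLp_disk_of_continuous (partialDeriv_contDiff hφ i).continuous 2
  memLp_second i j := memLp_disk_of_continuous
    (partialDeriv_contDiff (partialDeriv_contDiff hφ i) j).continuous 2
  first i := hasWeakPartial_of_contDiff hφ i
  second i j := hasWeakPartial_of_contDiff (partialDeriv_contDiff hφ i) j

theorem tendsto_eLpNorm_two_zero_of_bounded {f : ℕ → Plane → ℝ} {C : ℝ}
    (hf : ∀ k, AEStronglyMeasurable (f k) diskMeasure)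
    (hC : ∀ k, ∀ x ∈ unitDisk, |f k x| ≤ C)
    (hlim : ∀ x ∈ unitDisk, Tendsto (fun k => f k x) atTop (𝓝 0)) :
    Tendsto (fun k => eLpNorm (f k) 2 diskMeasure) atTop (𝓝 0) := by
  have h1 : Tendsto (fun k => ∫⁻ x, ‖f k x‖ₑ ^ (2 : ℝ) ∂diskMeasure) atTop
      (𝓝 (∫⁻ _, 0 ∂diskMeasure)) := by
    refine tendsto_lintegral_of_dominated_convergence' (fun _ => ENNReal.ofReal C ^ (2 : ℝ))
      (fun k => (hf k).enorm.pow_const _) (fun k => ?_) ?_ ?_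
    · filter_upwards [ae_restrict_mem Metric.isOpen_ball.measurableSet] with x hx
      gcongr
      rw [Real.enorm_eq_ofReal_abs]
      exact ENNReal.ofReal_le_ofReal (hC k x hx)
    · rw [lintegral_const]
      exact ENNReal.mul_ne_top (by simp) (measure_ne_top _ _)
    · filter_upwards [ae_restrict_mem Metric.isOpen_ball.measurableSet] with x hx
      have := ((ENNReal.continuous_rpow_const (y := 2)).comp continuous_enorm).tendsto (0 : ℝ)
      simp only [Function.comp_def, enorm_zero, ENNReal.zero_rpow_of_pos two_pos] at this
      exact this.comp (hlim x hx)
  have h2 := ((ENNReal.continuous_rpow_const (y := 1 / 2)).tendsto _).comp h1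
  simp only [eLpNorm_eq_lintegral_rpow_enorm_toReal (p := 2) two_ne_zero ENNReal.ofNat_ne_top]
  simpa [Function.comp_def] using h2

/-- A smooth function equal to one far from the unit circle and vanishing near and outside it. -/
noncomputable def edgeCutoff (k : ℕ) (s : ℝ) : ℝ := Real.smoothTransition ((k + 1) * (1 - s) - 1)

theorem edgeCutoff_contDiff (k : ℕ) : ContDiff ℝ ∞ (edgeCutoff k) :=
  Real.smoothTransition.contDiff.comp (by fun_prop)

theorem edgeCutoff_eq_zero {k : ℕ} {s : ℝ} (hs : 1 - 1 / ((k : ℝ) + 1) ≤ s) :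
    edgeCutoff k s = 0 := by
  apply Real.smoothTransition.zero_of_nonpos
  have : (0 : ℝ) < k + 1 := by positivity
  have h2 : 1 - s ≤ 1 / ((k : ℝ) + 1) := by linarith
  rw [le_div_iff₀ this] at h2
  linarith

theorem abs_one_sub_edgeCutoff_le (k : ℕ) (s : ℝ) : |1 - edgeCutoff k s| ≤ 1 := by
  have h1 := Real.smoothTransition.nonneg ((k + 1) * (1 - s) - 1)
  have h2 := Real.smoothTransition.le_one ((k + 1) * (1 - s) - 1)
  rw [edgeCutoff, abs_le]
  constructor <;> linarith

theorem tendsto_one_sub_edgeCutoff {s : ℝ} (hs : s < 1) :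
    Tendsto (fun k => 1 - edgeCutoff k s) atTop (𝓝 0) := by
  apply tendsto_const_nhds.congr'
  obtain ⟨n, hn⟩ := exists_nat_ge (2 / (1 - s))
  filter_upwards [eventually_ge_atTop n] with k hk
  have hk' : (n : ℝ) ≤ k := by exact_mod_cast hk
  rw [div_le_iff₀ (by linarith)] at hn
  rw [edgeCutoff, Real.smoothTransition.one_of_one_le, sub_self]
  nlinarith

/-- The cutoff multiplies the density `a`, not the potential. The gradient of the truncated
potential is then `-2 a χ x`, with no derivative of the cutoff `χ`, so bounded convergence alone
yields convergence in `H¹`. -/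
theorem isDiskTestFunction_radialPotential {a : ℝ → ℝ} (ha : ContDiff ℝ ∞ a) (k : ℕ) :
    IsDiskTestFunction (radialPotential fun s => a s * edgeCutoff k s) := by
  have hk : (0 : ℝ) < 1 / (k + 1) := by positivity
  have hclosed : IsClosed {x : Plane | ‖x‖ ^ 2 ≤ 1 - 1 / ((k : ℝ) + 1)} :=
    isClosed_le (by fun_prop) continuous_const
  have hsub : tsupport (radialPotential fun s => a s * edgeCutoff k s) ⊆
      {x : Plane | ‖x‖ ^ 2 ≤ 1 - 1 / ((k : ℝ) + 1)} := by
    refine closure_minimal (fun x hx => ?_) hclosed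
    by_contra hx'
    refine hx ?_
    rw [Set.mem_ofPred_eq, not_le] at hx'
    rw [radialPotential, intervalIntegral.integral_zero_ae]
    refine Eventually.of_forall fun τ hτ => ?_
    rw [edgeCutoff_eq_zero, mul_zero]
    rcases le_total (‖x‖ ^ 2) 1 with h | h
    · rw [Set.uIoc_of_le h] at hτ
      linarith [hτ.1]
    · rw [Set.uIoc_of_ge h] at hτ
      linarith [hτ.1]
  have hsub' : tsupport (radialPotential fun s => a s * edgeCutoff k s) ⊆ unitDisk := by
    refine hsub.trans fun x hx => ?_
    rw [Set.mem_ofPred_eq] at hx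
    rw [mem_ball_zero_iff]
    nlinarith [norm_nonneg x]
  exact ⟨radialPotential_contDiff (ha.mul (edgeCutoff_contDiff k)),
    (isCompact_closedBall (0 : Plane) 1).of_isClosed_subset (isClosed_tsupport _)
      (hsub'.trans Metric.ball_subset_closedBall), hsub'⟩

theorem norm_sq_mem_Ico_of_mem_disk {x : Plane} (hx : x ∈ unitDisk) :
    ‖x‖ ^ 2 ∈ Set.Ico (0 : ℝ) 1 := by
  rw [mem_ball_zero_iff] at hx
  exact ⟨by positivity, by nlinarith [norm_nonneg x]⟩

theorem abs_apply_le_one_of_mem_disk {x : Plane} (hx : x ∈ unitDisk) (i : Fin 2) :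
    |x i| ≤ 1 :=
  (PiLp.norm_apply_le x i).trans (mem_ball_zero_iff.1 hx).le

theorem isH10_radialPotential {a : ℝ → ℝ} (ha : ContDiff ℝ ∞ a) :
    IsH10 (radialPotential a) (fun i => partialDeriv i (radialPotential a)) := by
  have hac := ha.continuous
  have hcc := fun k => (edgeCutoff_contDiff k).continuous
  obtain ⟨C, hC⟩ := isCompact_Icc.exists_bound_of_continuousOn
    (s := Set.Icc (0 : ℝ) 1) hac.continuousOn
  have hC0 : 0 ≤ C := (norm_nonneg _).trans (hC 0 (by simp))
  have hb : ∀ k, ∀ s ∈ Set.Icc (0 : ℝ) 1, |a s * (1 - edgeCutoff k s)| ≤ C := fun k s hs => by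
    rw [abs_mul]
    exact (mul_le_mul (hC s hs) (abs_one_sub_edgeCutoff_le k s) (abs_nonneg _) hC0).trans
      (mul_one C).le
  refine ⟨fun k => radialPotential fun s => a s * edgeCutoff k s,
    isDiskTestFunction_radialPotential ha, ?_, fun i => ?_⟩
  · have hd : ∀ k x, radialPotential a x - radialPotential (fun s => a s * edgeCutoff k s) x
        = ∫ τ in (‖x‖ ^ 2)..1, a τ * (1 - edgeCutoff k τ) := fun k x => by
      simp only [mul_sub, mul_one]
      exact (intervalIntegral.integral_sub (hac.intervalIntegrable _ _)
        ((hac.mul (hcc k)).intervalIntegrable _ _)).symm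
    simp only [hd]
    refine tendsto_eLpNorm_two_zero_of_bounded (C := C) (fun k => ?_) (fun k x hx => ?_)
      fun x hx => ?_
    · exact (radialPotential_contDiff (ha.mul (contDiff_const.sub
        (edgeCutoff_contDiff k)))).continuous.aestronglyMeasurable
    · have hs := norm_sq_mem_Ico_of_mem_disk hx
      rw [← Real.norm_eq_abs]
      refine (intervalIntegral.norm_integral_le_of_norm_le_const (C := C) fun τ hτ => ?_).trans ?_
      · rw [Set.uIoc_of_le hs.2.le] at hτ
        exact hb k τ ⟨hs.1.trans hτ.1.le, hτ.2⟩
      · rw [abs_of_nonneg (by linarith [hs.2])]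
        nlinarith [hs.1]
    · have hs := norm_sq_mem_Ico_of_mem_disk hx
      have := intervalIntegral.tendsto_integral_filter_of_dominated_convergence
        (μ := volume) (l := atTop) (a := ‖x‖ ^ 2) (b := 1)
        (F := fun k τ => a τ * (1 - edgeCutoff k τ)) (f := fun _ => 0) (fun _ => C) ?_ ?_ ?_ ?_
      · simpa using this
      · exact Eventually.of_forall fun k =>
          (hac.mul (continuous_const.sub (hcc k))).aestronglyMeasurable
      · refine Eventually.of_forall fun k => Eventually.of_forall fun τ hτ => ?_
        rw [Set.uIoc_of_le hs.2.le] at hτ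
        exact hb k τ ⟨hs.1.trans hτ.1.le, hτ.2⟩
      · exact intervalIntegrable_const
      -- At `τ = 1` every cutoff vanishes, so pointwise convergence fails there.
      · have h1 : ∀ᵐ τ : ℝ, τ ≠ 1 := by simp [ae_iff]
        filter_upwards [h1] with τ hτ1 hτ
        rw [Set.uIoc_of_le hs.2.le] at hτ
        simpa using (tendsto_one_sub_edgeCutoff (lt_of_le_of_ne hτ.2 hτ1)).const_mul (a τ)
  · have hd : ∀ k x, partialDeriv i (radialPotential a) x
        - partialDeriv i (radialPotential fun s => a s * edgeCutoff k s) x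
        = a (‖x‖ ^ 2) * (1 - edgeCutoff k (‖x‖ ^ 2)) * (-2 * x i) := fun k x => by
      rw [partialDeriv_radialPotential hac,
        partialDeriv_radialPotential (a := fun s => a s * edgeCutoff k s) (hac.mul (hcc k))]
      ring
    simp only [hd]
    refine tendsto_eLpNorm_two_zero_of_bounded (C := C * 2) (fun k => ?_) (fun k x hx => ?_)
      fun x hx => ?_
    · have := hcc k
      exact Continuous.aestronglyMeasurable (by fun_prop)
    · have hs := norm_sq_mem_Ico_of_mem_disk hx
      rw [abs_mul]
      refine mul_le_mul (hb k _ ⟨hs.1, hs.2.le⟩) ?_ (abs_nonneg _) hC0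
      rw [abs_mul, abs_neg, abs_two]
      linarith [abs_apply_le_one_of_mem_disk hx i]
    · simpa using ((tendsto_one_sub_edgeCutoff
        (norm_sq_mem_Ico_of_mem_disk hx).2).const_mul (a (‖x‖ ^ 2))).mul_const (-2 * x i)

/-! ### Polar coordinates and the variable |x|² -/

/-- Almost every property in the disk holds along almost every ray. -/
theorem ae_ae_ray_of_ae_disk {P : Plane → Prop} (h : ∀ᵐ x ∂diskMeasure, P x) :
    ∀ᵐ z : Metric.sphere (0 : Plane) 1 ∂circleMeasure, ∀ᵐ r : ℝ, r ∈ Set.Ioo (0 : ℝ) 1 → P (r • (z : Plane)) := by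
  rw [ae_restrict_iff' Metric.isOpen_ball.measurableSet] at h
  have h1 : ∀ᵐ x : ({0}ᶜ : Set Plane) ∂(Measure.comap (Subtype.val : ({0}ᶜ : Set Plane) → Plane) volume),
      (x : Plane) ∈ unitDisk → P x :=
    (ae_restrict_iff_subtype (measurableSet_singleton (0 : Plane)).compl (p := fun x =>
      x ∈ unitDisk → P x)).1 (ae_restrict_of_ae h)
  have h2 := (((volume : Measure Plane).measurePreserving_homeomorphUnitSphereProd.symm
    (homeomorphUnitSphereProd Plane).toMeasurableEquiv).quasiMeasurePreserving).ae h1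
  have h3 := Measure.ae_ae_of_ae_prod h2
  filter_upwards [h3] with z hz
  -- The radial factor of the polar measure is `r dr`. Its density is nonzero on `(0, ∞)`, so its
  -- null sets there are the Lebesgue null sets.
  rw [Measure.volumeIoiPow, ae_withDensity_iff (by fun_prop)] at hz
  have hz' := (ae_restrict_iff_subtype measurableSet_Ioi (p := fun r : ℝ =>
    r ∈ Set.Ioo (0 : ℝ) 1 → P (r • (z : Plane)))).2 (hz.mono fun r hr hr1 => by
      refine hr ?_ ?_
      · have : (0 : ℝ) < r := r.2
        simp only [ne_eq, ENNReal.ofReal_eq_zero, not_le]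
        positivity
      · have h0 : (0 : ℝ) < r := r.2
        have h1 : ‖(z : Plane)‖ = 1 := mem_sphere_zero_iff_norm.1 z.2
        have : ‖(r : ℝ) • (z : Plane)‖ < 1 := by
          rw [norm_smul, h1, mul_one, Real.norm_of_nonneg h0.le]
          exact hr1.2
        exact mem_ball_zero_iff.2 this)
  rw [ae_restrict_iff' measurableSet_Ioi] at hz'
  filter_upwards [hz'] with r hr hr1
  exact hr hr1.1 hr1

theorem integral_disk_polar {h : Plane → ℝ} (hh : IntegrableOn h unitDisk) :
    ∫ x in unitDisk, h x =
      ∫ z, (∫ r in (0 : ℝ)..1, r * h (r • (z : Plane))) ∂circleMeasure := by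
  have hball := (Metric.isOpen_ball (x := (0 : Plane)) (ε := 1)).measurableSet
  have h0 := (measurableSet_singleton (0 : Plane)).compl
  rw [← integral_indicator hball]
  set H := Set.indicator unitDisk h with hH
  have hint : Integrable H := (integrable_indicator_iff hball).2 hh
  have mp := (volume : Measure Plane).measurePreserving_homeomorphUnitSphereProd.symm
    (homeomorphUnitSphereProd Plane).toMeasurableEquiv
  have hint1 : Integrable (fun x : ({0}ᶜ : Set Plane) => H x)
      (Measure.comap (Subtype.val : ({0}ᶜ : Set Plane) → Plane) volume) :=
    (integrableOn_iff_comap_subtypeVal h0).1 hint.integrableOn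
  have hint2 := mp.integrable_comp_of_integrable hint1
  calc ∫ x, H x = ∫ x : ({0}ᶜ : Set Plane), H x ∂(Measure.comap Subtype.val volume) := by
        rw [integral_subtype_comap h0, restrict_compl_singleton]
    _ = _ := (mp.integral_comp (MeasurableEquiv.measurableEmbedding _)
          (fun x : ({0}ᶜ : Set Plane) => H x)).symm
    _ = _ := integral_prod _ hint2
    _ = _ := by
      refine integral_congr_ae (Eventually.of_forall fun z => ?_)
      have hz : ‖(z : Plane)‖ = 1 := mem_sphere_zero_iff_norm.1 z.2
      have e : ∀ r : Set.Ioi (0 : ℝ), H ((homeomorphUnitSphereProd Plane).symm (z, r) : Plane)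
          = H ((r : ℝ) • (z : Plane)) := fun r => by
        rw [homeomorphUnitSphereProd_symm_apply_coe]
      change ∫ r, H ((homeomorphUnitSphereProd Plane).symm (z, r) : Plane) ∂_ = _
      simp only [e, Measure.volumeIoiPow, ENNReal.ofReal]
      rw [integral_withDensity_eq_integral_smul (by fun_prop),
        integral_subtype_comap measurableSet_Ioi fun r : ℝ =>
          Real.toNNReal (r ^ (Module.finrank ℝ Plane - 1)) • H (r • (z : Plane)),
        intervalIntegral.integral_of_le zero_le_one, integral_Ioc_eq_integral_Ioo,
        ← integral_indicator measurableSet_Ioi, ← integral_indicator measurableSet_Ioo]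
      refine integral_congr_ae (Eventually.of_forall fun r => ?_)
      simp only [hH, Set.indicator, Set.mem_Ioi, Set.mem_Ioo, mem_ball_zero_iff, norm_smul, hz,
        mul_one, Real.norm_eq_abs]
      by_cases hr : 0 < r
      · by_cases hr1 : r < 1
        · simp [hr, hr1, abs_of_pos, NNReal.smul_def, hr.le]
        · simp [hr, hr1, abs_of_pos]
      · simp [hr]

/-- The disk of radius `√s` has area `π s`, so `|x|²` is uniformly distributed; comparing the
measures on half-lines is enough. -/
theorem map_norm_sq_diskMeasure :
    Measure.map (fun x : Plane => ‖x‖ ^ 2) diskMeasure =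
      ENNReal.ofReal Real.pi • volume.restrict (Set.Ioc (0 : ℝ) 1) := by
  have : IsFiniteMeasure (Measure.map (fun x : Plane => ‖x‖ ^ 2) diskMeasure) :=
    Measure.isFiniteMeasure_map _ _
  have hball := (Metric.isOpen_ball (x := (0 : Plane)) (ε := 1)).measurableSet
  refine Measure.ext_of_Iic _ _ fun s => ?_
  rw [Measure.map_apply (by fun_prop) measurableSet_Iic, Measure.restrict_apply
    (measurableSet_Iic.preimage (by fun_prop)), Measure.smul_apply,
    Measure.restrict_apply measurableSet_Iic, smul_eq_mul]
  rcases lt_or_ge s 0 with hs | hs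
  · have h1 : (fun x : Plane => ‖x‖ ^ 2) ⁻¹' Set.Iic s ∩ unitDisk = ∅ := by
      ext x
      simp only [Set.mem_inter_iff, Set.mem_preimage, Set.mem_Iic, Set.mem_empty_iff_false,
        iff_false, not_and]
      intro h
      nlinarith [sq_nonneg ‖x‖]
    have h2 : Set.Iic s ∩ Set.Ioc (0 : ℝ) 1 = ∅ := by
      ext x
      simp only [Set.mem_inter_iff, Set.mem_Iic, Set.mem_Ioc, Set.mem_empty_iff_false,
        iff_false, not_and]
      intro h h'
      linarith
    rw [h1, h2]
    simp
  · rcases lt_or_ge s 1 with hs1 | hs1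
    · have h1 : (fun x : Plane => ‖x‖ ^ 2) ⁻¹' Set.Iic s ∩ unitDisk
          = Metric.closedBall 0 (√s) := by
        ext x
        simp only [Set.mem_inter_iff, Set.mem_preimage, Set.mem_Iic, mem_ball_zero_iff,
          mem_closedBall_zero_iff]
        rw [Real.le_sqrt (norm_nonneg x) hs, and_iff_left_iff_imp]
        intro h
        nlinarith [norm_nonneg x]
      have h2 : Set.Iic s ∩ Set.Ioc (0 : ℝ) 1 = Set.Ioc 0 s := by
        ext x
        simp only [Set.mem_inter_iff, Set.mem_Iic, Set.mem_Ioc]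
        constructor
        · rintro ⟨h, h', -⟩
          exact ⟨h', h⟩
        · rintro ⟨h, h'⟩
          exact ⟨h', h, h'.trans hs1.le⟩
      rw [h1, h2, EuclideanSpace.volume_closedBall_fin_two, Real.volume_Ioc, sub_zero,
        ← ENNReal.ofReal_pow (Real.sqrt_nonneg s), Real.sq_sqrt hs, mul_comm,
        ENNReal.ofReal_eq_coe_nnreal Real.pi_nonneg]
    · have h1 : (fun x : Plane => ‖x‖ ^ 2) ⁻¹' Set.Iic s ∩ unitDisk = unitDisk := by
        ext x
        simp only [Set.mem_inter_iff, Set.mem_preimage, Set.mem_Iic, and_iff_right_iff_imp]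
        intro h
        exact (norm_sq_mem_Ico_of_mem_disk h).2.le.trans hs1
      have h2 : Set.Iic s ∩ Set.Ioc (0 : ℝ) 1 = Set.Ioc 0 1 := by
        ext x
        simp only [Set.mem_inter_iff, Set.mem_Iic, Set.mem_Ioc, and_iff_right_iff_imp]
        intro h
        exact h.2.trans hs1
      rw [h1, h2, EuclideanSpace.volume_ball_fin_two, Real.volume_Ioc, sub_zero,
        ENNReal.ofReal_one, one_pow, one_mul, mul_one,
        ENNReal.ofReal_eq_coe_nnreal Real.pi_nonneg]

theorem ae_disk_norm_sq_of_ae_Ioc {P : ℝ → Prop} (h : ∀ᵐ s : ℝ, s ∈ Set.Ioc (0 : ℝ) 1 → P s) :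
    ∀ᵐ x ∂diskMeasure, P (‖x‖ ^ 2) := by
  have h1 : ∀ᵐ s ∂(Measure.map (fun x : Plane => ‖x‖ ^ 2) diskMeasure), P s := by
    rw [map_norm_sq_diskMeasure]
    exact Measure.ae_smul_measure ((ae_restrict_iff' measurableSet_Ioc).2 h) _
  exact ae_of_ae_map (by fun_prop) h1

theorem ae_Ioc_of_ae_disk_norm_sq {P : ℝ → Prop} (hP : MeasurableSet {s | P s})
    (h : ∀ᵐ x ∂diskMeasure, P (‖x‖ ^ 2)) : ∀ᵐ s ∂volume.restrict (Set.Ioc (0 : ℝ) 1), P s := by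
  have h1 := (ae_map_iff (μ := diskMeasure) (f := fun x : Plane => ‖x‖ ^ 2)
    (by fun_prop) hP).2 h
  rw [map_norm_sq_diskMeasure] at h1
  have hπ : ENNReal.ofReal Real.pi ≠ 0 := by simp [Real.pi_pos]
  exact (Measure.absolutelyContinuous_smul hπ).ae_le h1

theorem integral_disk_norm_sq {F : ℝ → ℝ}
    (hF : AEStronglyMeasurable F (volume.restrict (Set.Ioc (0 : ℝ) 1))) :
    ∫ x in unitDisk, F (‖x‖ ^ 2) = Real.pi * ∫ s in (0 : ℝ)..1, F s := by
  have := integral_map (μ := diskMeasure) (φ := fun x : Plane => ‖x‖ ^ 2) (f := F) (by fun_prop)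
    (by rw [map_norm_sq_diskMeasure]; exact hF.smul_measure _)
  rw [← this, map_norm_sq_diskMeasure, integral_smul_measure,
    intervalIntegral.integral_of_le zero_le_one, ENNReal.toReal_ofReal Real.pi_nonneg, smul_eq_mul]

/-- The gradient of `φ` is radial, so `r (∇φ·∇ψ + Δφ ψ)` is the exact derivative in `r` of `-2 r²
a(r²) ψ(r z)` along the ray through `z`. The fundamental theorem of calculus on each ray replaces
the divergence theorem. -/
theorem isNormalDeriv_radialPotential {a : ℝ → ℝ} (ha : ContDiff ℝ ∞ a) :
    IsNormalDeriv (fun i => partialDeriv i (radialPotential a))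
      (fun i j => partialDeriv j (partialDeriv i (radialPotential a)))
      (fun _ => -2 * a 1) where
  memLp := memLp_const _
  green ψ hψ := by
    have hda : Continuous (deriv a) := ha.continuous_deriv (by simp)
    have hψi : ∀ i, Continuous (partialDeriv i ψ) := fun i =>
      (partialDeriv_contDiff hψ i).continuous
    have hac := ha.continuous
    have hψc := hψ.continuous
    simp only [weakLaplacian_radialPotential ha]
    simp only [partialDeriv_radialPotential hac]
    have hcont : Continuous fun x : Plane => (∑ i, -2 * a (‖x‖ ^ 2) * x i * partialDeriv i ψ x) +
        -(4 * a (‖x‖ ^ 2) + 4 * ‖x‖ ^ 2 * deriv a (‖x‖ ^ 2)) * ψ x := by fun_prop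
    rw [integral_disk_polar ((memLp_disk_of_continuous hcont 1).integrable le_rfl)]
    refine integral_congr_ae (Eventually.of_forall fun z => ?_)
    have hz : ‖(z : Plane)‖ = 1 := mem_sphere_zero_iff_norm.1 z.2
    have hderiv : ∀ r : ℝ, HasDerivAt (fun r : ℝ => -2 * r ^ 2 * a (r ^ 2) * ψ (r • (z : Plane)))
        (r * ((∑ i, -2 * a (‖r • (z : Plane)‖ ^ 2) * (r • (z : Plane)) i *
          partialDeriv i ψ (r • (z : Plane))) +
        -(4 * a (‖r • (z : Plane)‖ ^ 2) + 4 * ‖r • (z : Plane)‖ ^ 2 *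
          deriv a (‖r • (z : Plane)‖ ^ 2)) * ψ (r • (z : Plane)))) r := fun r => by
      have h1 : HasDerivAt (fun r : ℝ => -2 * r ^ 2) (-4 * r) r := by
        have := (hasDerivAt_pow 2 r).const_mul (-2)
        exact this.congr_deriv (by ring)
      have h2 : HasDerivAt (fun r : ℝ => a (r ^ 2)) (deriv a (r ^ 2) * (2 * r)) r := by
        have := ((ha.differentiable (by simp)) (r ^ 2)).hasDerivAt.comp r (hasDerivAt_pow 2 r)
        simpa using! this
      have h3 : HasDerivAt (fun r : ℝ => ψ (r • (z : Plane)))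
          (fderiv ℝ ψ (r • (z : Plane)) (z : Plane)) r := by
        have := (hψ.differentiable (by simp) (r • (z : Plane))).hasFDerivAt.comp_hasDerivAt r
          ((hasDerivAt_id r).smul_const (z : Plane))
        simpa using! this
      have hexp : (z : Plane) = ∑ i, (z : Plane) i • EuclideanSpace.single i (1 : ℝ) := by
        ext j
        fin_cases j <;> simp
      have h4 : fderiv ℝ ψ (r • (z : Plane)) (z : Plane)
          = ∑ i, (z : Plane) i * partialDeriv i ψ (r • (z : Plane)) := by
        conv_lhs => rw [hexp]
        simp only [map_sum, map_smul, smul_eq_mul, partialDeriv]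
        rw [← hexp]
      refine ((h1.mul h2).mul h3).congr_deriv ?_
      rw [h4, norm_smul, hz, mul_one, Real.norm_eq_abs, sq_abs]
      simp only [Fin.sum_univ_two, PiLp.smul_apply, smul_eq_mul, Pi.mul_apply]
      ring
    dsimp only
    rw [intervalIntegral.integral_eq_sub_of_hasDerivAt (fun r _ => hderiv r)]
    · simp
    · refine Continuous.intervalIntegrable ?_ _ _
      exact continuous_id.mul (hcont.comp (by fun_prop : Continuous fun r : ℝ => r • (z : Plane)))

/-! ### Measurable profiles and radial averages -/

/-- A radial function which is a.e. strongly measurable has a measurable radial profile. -/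
theorem exists_measurable_radial_profile {u : Plane → ℝ} (hu : AEStronglyMeasurable u diskMeasure)
    (h : IsRadialOnDisk u) :
    ∃ G : ℝ → ℝ, Measurable G ∧ ∀ᵐ x ∂diskMeasure, u x = G (‖x‖ ^ 2) := by
  obtain ⟨F, hF⟩ := h
  have h1 : ∀ᵐ x ∂diskMeasure, hu.mk u x = F ‖x‖ := by
    filter_upwards [hF, hu.ae_eq_mk] with x hx hx'
    rw [← hx', hx]
  have hne : (ae circleMeasure).NeBot := by
    rw [ae_neBot]
    exact Measure.toSphere_ne_zero _
  -- `F` need not be measurable. Restricting a measurable representative of `u` to a single good ray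
  -- supplies a measurable substitute.
  obtain ⟨z, hz⟩ := (ae_ae_ray_of_ae_disk h1).exists
  have hz1 : ‖(z : Plane)‖ = 1 := mem_sphere_zero_iff_norm.1 z.2
  refine ⟨fun s => hu.mk u (√s • (z : Plane)),
    hu.stronglyMeasurable_mk.measurable.comp (by fun_prop), ?_⟩
  have h2 : ∀ᵐ s : ℝ, s ∈ Set.Ioc (0 : ℝ) 1 → hu.mk u (√s • (z : Plane)) = F (√s) := by
    -- The exceptional set of radii stays null under squaring, since differentiable maps of the line
    -- send null sets to null sets.
    have hnull : volume ((fun r : ℝ => r ^ 2) ''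
        {r | ¬ (r ∈ Set.Ioo (0 : ℝ) 1 → hu.mk u (r • (z : Plane)) = F ‖r • (z : Plane)‖)}) = 0 :=
      addHaar_image_eq_zero_of_differentiableOn_of_addHaar_eq_zero volume (by fun_prop) hz
    have h1 : ∀ᵐ τ : ℝ, τ ≠ 1 := by simp [ae_iff]
    filter_upwards [measure_eq_zero_iff_ae_notMem.1 hnull, h1] with s hs hs1 hs01
    by_contra hcon
    refine hs ⟨√s, ?_, Real.sq_sqrt hs01.1.le⟩
    intro hcon'
    refine hcon ?_
    have := hcon' ⟨Real.sqrt_pos.2 hs01.1, by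
      rw [Real.sqrt_lt' one_pos, one_pow]
      exact lt_of_le_of_ne hs01.2 hs1⟩
    rwa [norm_smul, hz1, mul_one, Real.norm_of_nonneg (Real.sqrt_nonneg s)] at this
  filter_upwards [hF, ae_disk_norm_sq_of_ae_Ioc h2] with x hx hx'
  rw [hx, hx', Real.sqrt_sq (norm_nonneg x)]

/-- The radial average `a` of `ρ`, characterised by `4 s a(s) = ∫₀ˢ ρ`, is smooth when `ρ` is
smooth and constant near the origin. -/
theorem exists_contDiff_average {ρ : ℝ → ℝ} (hρ : ContDiff ℝ ∞ ρ) {δ c : ℝ} (hδ : 0 < δ)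
    (h : ∀ s ≤ δ, ρ s = c) :
    ∃ a : ℝ → ℝ, ContDiff ℝ ∞ a ∧ ∀ s, 4 * s * a s = ∫ τ in (0 : ℝ)..s, ρ τ := by
  classical
  have hint : ∀ s ≤ δ, ∫ τ in (0 : ℝ)..s, ρ τ = s * c := fun s hs => by
    rw [intervalIntegral.integral_congr (g := fun _ => c) fun τ hτ => h τ ?_]
    · simp
    · exact hτ.2.trans (max_le hδ.le hs)
  -- Switching at `δ / 2` lets the two formulas agree on `(δ/2, δ)`, so each point has a
  -- neighbourhood on which one smooth formula is valid.
  set a : ℝ → ℝ := fun s => if s ≤ δ / 2 then c / 4 else (∫ τ in (0 : ℝ)..s, ρ τ) / (4 * s)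
    with ha
  have ha1 : ∀ s < δ, a s = c / 4 := fun s hs => by
    by_cases hs2 : s ≤ δ / 2
    · simp only [ha, if_pos hs2]
    · have : s ≠ 0 := by
        rintro rfl
        exact hs2 (by positivity)
      simp only [ha, if_neg hs2, hint s hs.le]
      field_simp
  have ha2 : ∀ s > δ / 2, a s = (∫ τ in (0 : ℝ)..s, ρ τ) / (4 * s) := fun s hs => by
    simp only [ha, if_neg hs.not_ge]
  refine ⟨a, contDiff_iff_contDiffAt.2 fun s => ?_, fun s => ?_⟩
  · rcases lt_or_ge s δ with hs | hs
    · exact contDiffAt_const.congr_of_eventuallyEq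
        ((eventually_lt_nhds hs).mono fun τ hτ => ha1 τ hτ)
    · refine ContDiffAt.congr_of_eventuallyEq ?_
        ((eventually_gt_nhds (show δ / 2 < s by linarith)).mono fun τ hτ => ha2 τ hτ)
      exact (contDiff_primitive hρ 0).contDiffAt.div (by fun_prop) (by
        have : 0 < s := hδ.trans_le hs
        positivity)
  · rcases lt_or_ge s δ with hs | hs
    · rw [ha1 s hs, hint s hs.le]
      ring
    · have : 0 < s := hδ.trans_le hs
      rw [ha2 s (by linarith)]
      field_simp

/-! ### Fluxes through concentric circles -/

/-- The integral of `h` over the disk `{|x|² < τ}`, for `τ ≤ 1`. -/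
noncomputable def diskCumulative (h : Plane → ℝ) (τ : ℝ) : ℝ :=
  ∫ x in unitDisk, Set.indicator {x : Plane | ‖x‖ ^ 2 < τ} h x

theorem measurableSet_norm_sq_lt (τ : ℝ) : MeasurableSet {x : Plane | ‖x‖ ^ 2 < τ} :=
  (isOpen_lt (by fun_prop) continuous_const).measurableSet

theorem diskCumulative_one (h : Plane → ℝ) : diskCumulative h 1 = ∫ x in unitDisk, h x := by
  refine setIntegral_congr_fun Metric.isOpen_ball.measurableSet fun x hx => ?_
  exact Set.indicator_of_mem (s := {x : Plane | ‖x‖ ^ 2 < 1}) (norm_sq_mem_Ico_of_mem_disk hx).2 h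

theorem ae_disk_norm_sq_ne (t : ℝ) : ∀ᵐ x ∂diskMeasure, ‖x‖ ^ 2 ≠ t := by
  refine ae_disk_norm_sq_of_ae_Ioc (P := fun s => s ≠ t) ?_
  have h1 : ∀ᵐ τ : ℝ, τ ≠ t := by simp [ae_iff]
  filter_upwards [h1] with s hs _ using hs

theorem continuous_diskCumulative {h : Plane → ℝ} (hh : Integrable h diskMeasure) :
    Continuous (diskCumulative h) := by
  refine continuous_iff_continuousAt.2 fun t => ?_
  refine continuousAt_of_dominated (bound := fun x => ‖h x‖) ?_ ?_ hh.norm ?_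
  · exact Eventually.of_forall fun τ =>
      hh.aestronglyMeasurable.indicator (measurableSet_norm_sq_lt τ)
  · exact Eventually.of_forall fun τ => Eventually.of_forall fun x => norm_indicator_le_norm_self _ _
  · filter_upwards [ae_disk_norm_sq_ne t] with x hx
    rcases lt_or_gt_of_ne hx with hlt | hgt
    · refine continuousAt_const.congr (f := fun _ => h x) ?_
      filter_upwards [eventually_gt_nhds hlt] with τ hτ
      exact (Set.indicator_of_mem (s := {x : Plane | ‖x‖ ^ 2 < τ}) hτ h).symm
    · refine continuousAt_const.congr (f := fun _ => 0) ?_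
      filter_upwards [eventually_lt_nhds hgt] with τ hτ
      exact (Set.indicator_of_notMem (s := {x : Plane | ‖x‖ ^ 2 < τ}) hτ.not_gt h).symm

/-- Fubini on `{|x|² < τ}`. This is the duality between densities and fluxes that later identifies
`u`; `a` is only assumed integrable because the density attached to `u` may be singular at `0`. -/
theorem integral_mul_radialPotential {h : Plane → ℝ} {a : ℝ → ℝ} (hh : Integrable h diskMeasure)
    (ha : IntervalIntegrable a volume 0 1) :
    ∫ x in unitDisk, h x * radialPotential a x = ∫ τ in (0 : ℝ)..1, a τ * diskCumulative h τ := by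
  have ha' : Integrable a (volume.restrict (Set.Ioc (0 : ℝ) 1)) :=
    (intervalIntegrable_iff_integrableOn_Ioc_of_le zero_le_one).1 ha
  set S : Set (Plane × ℝ) := {p | ‖p.1‖ ^ 2 < p.2} with hS
  have hSm : MeasurableSet S := (isOpen_lt (by fun_prop) (by fun_prop)).measurableSet
  have hprod : Integrable (S.indicator fun p : Plane × ℝ => h p.1 * a p.2)
      (diskMeasure.prod (volume.restrict (Set.Ioc (0 : ℝ) 1))) :=
    (hh.mul_prod ha').indicator hSm
  have hswap := integral_integral_swap (f := fun x τ => S.indicator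
    (fun p : Plane × ℝ => h p.1 * a p.2) (x, τ)) hprod
  calc ∫ x in unitDisk, h x * radialPotential a x
      = ∫ x in unitDisk, ∫ τ in Set.Ioc (0 : ℝ) 1,
          S.indicator (fun p : Plane × ℝ => h p.1 * a p.2) (x, τ) := by
        refine setIntegral_congr_fun Metric.isOpen_ball.measurableSet fun x hx => ?_
        have hs := norm_sq_mem_Ico_of_mem_disk hx
        have e : (fun τ => S.indicator (fun p : Plane × ℝ => h p.1 * a p.2) (x, τ))
            = (Set.Ioi (‖x‖ ^ 2)).indicator fun τ => h x * a τ := by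
          funext τ
          simp only [Set.indicator, hS, Set.mem_ofPred_eq, Set.mem_Ioi]
        have e2 : Set.Ioc (0 : ℝ) 1 ∩ Set.Ioi (‖x‖ ^ 2) = Set.Ioc (‖x‖ ^ 2) 1 := by
          ext τ
          simp only [Set.mem_inter_iff, Set.mem_Ioc, Set.mem_Ioi]
          exact ⟨fun H => ⟨H.2, H.1.2⟩, fun H => ⟨⟨hs.1.trans_lt H.1, H.2⟩, H.1⟩⟩
        rw [e, setIntegral_indicator measurableSet_Ioi, e2, integral_const_mul, radialPotential,
          intervalIntegral.integral_of_le hs.2.le]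
    _ = ∫ τ in Set.Ioc (0 : ℝ) 1, ∫ x in unitDisk,
          S.indicator (fun p : Plane × ℝ => h p.1 * a p.2) (x, τ) := hswap
    _ = _ := by
        rw [intervalIntegral.integral_of_le zero_le_one]
        refine integral_congr_ae (Eventually.of_forall fun τ => ?_)
        dsimp only
        rw [diskCumulative, ← integral_const_mul]
        refine integral_congr_ae (Eventually.of_forall fun x => ?_)
        simp only [Set.indicator, hS, Set.mem_ofPred_eq]
        split_ifs
        · ring
        · ring

theorem diskCumulative_norm_sq {ρ : ℝ → ℝ} (hρ : Continuous ρ) {τ : ℝ}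
    (hτ : τ ∈ Set.Ioc (0 : ℝ) 1) :
    diskCumulative (fun x => ρ (‖x‖ ^ 2)) τ = Real.pi * ∫ s in (0 : ℝ)..τ, ρ s := by
  have e : ∀ x : Plane, Set.indicator {x : Plane | ‖x‖ ^ 2 < τ} (fun x => ρ (‖x‖ ^ 2)) x
      = (Set.Iio τ).indicator ρ (‖x‖ ^ 2) := fun x => by
    simp only [Set.indicator, Set.mem_ofPred_eq, Set.mem_Iio]
  simp only [diskCumulative, e]
  rw [integral_disk_norm_sq (hρ.aestronglyMeasurable.indicator measurableSet_Iio),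
    intervalIntegral.integral_of_le zero_le_one, setIntegral_indicator measurableSet_Iio,
    intervalIntegral.integral_of_le hτ.1.le, integral_Ioc_eq_integral_Ioo (y := τ)]
  congr 3
  ext s
  simp only [Set.mem_inter_iff, Set.mem_Ioc, Set.mem_Iio, Set.mem_Ioo]
  exact ⟨fun H => ⟨H.1.1, H.2⟩, fun H => ⟨⟨H.1, H.2.le.trans hτ.2⟩, H.2⟩⟩

/-- Cauchy–Schwarz on a disk of area `π τ`, in the form `|h| ≤ (√τ/2) h² + 1/(2√τ)`. The gain of
`√τ` makes `M(τ)/τ` integrable at the origin. -/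
theorem abs_diskCumulative_le {h : Plane → ℝ} (hh : MemLp h 2 diskMeasure) :
    ∃ K, ∀ τ ∈ Set.Ioc (0 : ℝ) 1, |diskCumulative h τ| ≤ K * √τ := by
  refine ⟨((∫ x in unitDisk, h x ^ 2) + Real.pi) / 2, fun τ hτ => ?_⟩
  have hτ0 := Real.sqrt_pos.2 hτ.1
  have hsq : Integrable (fun x => h x ^ 2) diskMeasure := hh.integrable_sq
  have hone : diskCumulative (fun _ => 1) τ = Real.pi * τ := by
    rw [diskCumulative_norm_sq (ρ := fun _ => (1 : ℝ)) continuous_const hτ]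
    simp
  have hint1 : Integrable (Set.indicator {x : Plane | ‖x‖ ^ 2 < τ} fun _ => (1 : ℝ)) diskMeasure :=
    (integrable_const 1).indicator (measurableSet_norm_sq_lt τ)
  calc |diskCumulative h τ| ≤ ∫ x in unitDisk, (√τ / 2 * h x ^ 2 +
        1 / (2 * √τ) * Set.indicator {x : Plane | ‖x‖ ^ 2 < τ} (fun _ => 1) x) := by
        rw [← Real.norm_eq_abs, diskCumulative]
        refine norm_integral_le_of_norm_le ((hsq.const_mul _).add (hint1.const_mul _))
          (Eventually.of_forall fun x => ?_)
        by_cases hx : ‖x‖ ^ 2 < τ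
        · rw [Set.indicator_of_mem (s := {x : Plane | ‖x‖ ^ 2 < τ}) hx,
            Set.indicator_of_mem (s := {x : Plane | ‖x‖ ^ 2 < τ}) hx, Real.norm_eq_abs]
          have h1 : √τ / 2 * h x ^ 2 + 1 / (2 * √τ) * 1 - |h x|
              = (√τ * |h x| - 1) ^ 2 / (2 * √τ) := by
            rw [← sq_abs (h x)]
            field_simp
            ring
          have h2 : 0 ≤ (√τ * |h x| - 1) ^ 2 / (2 * √τ) := by positivity
          linarith
        · rw [Set.indicator_of_notMem (s := {x : Plane | ‖x‖ ^ 2 < τ}) hx,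
            Set.indicator_of_notMem (s := {x : Plane | ‖x‖ ^ 2 < τ}) hx, norm_zero]
          positivity
    _ = √τ / 2 * (∫ x in unitDisk, h x ^ 2) + 1 / (2 * √τ) * (Real.pi * τ) := by
        rw [integral_add (hsq.const_mul _) (hint1.const_mul _), integral_const_mul,
          integral_const_mul, ← hone, diskCumulative]
    _ = _ := by
        have : τ = √τ * √τ := (Real.mul_self_sqrt hτ.1.le).symm
        rw [show 1 / (2 * √τ) * (Real.pi * τ) = Real.pi / 2 * √τ by
          conv_lhs => rw [this, Real.sqrt_mul_self hτ0.le]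
          field_simp]
        ring

/-! ### Green's identity and recovery of u from its flux -/

theorem tendsto_integral_mul_of_tendsto_eLpNorm_two {u w : Plane → ℝ} {φ : ℕ → Plane → ℝ}
    (hu : MemLp u 2 diskMeasure) (hφ : ∀ k, MemLp (φ k) 2 diskMeasure)
    (hw : MemLp w 2 diskMeasure)
    (h : Tendsto (fun k => eLpNorm (fun x => u x - φ k x) 2 diskMeasure) atTop (𝓝 0)) :
    Tendsto (fun k => ∫ x in unitDisk, w x * φ k x) atTop (𝓝 (∫ x in unitDisk, w x * u x)) := by
  refine tendsto_integral_of_L1' (fun x => w x * u x) (hw.integrable_mul hu).aestronglyMeasurable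
    (Eventually.of_forall fun k => hw.integrable_mul (hφ k)) ?_
  have h0 : Tendsto (fun k => eLpNorm w 2 diskMeasure *
      eLpNorm (fun x => u x - φ k x) 2 diskMeasure) atTop (𝓝 0) := by
    simpa using ENNReal.Tendsto.const_mul h (Or.inr hw.eLpNorm_ne_top)
  refine tendsto_of_tendsto_of_tendsto_of_le_of_le tendsto_const_nhds h0 (fun _ => zero_le) fun k => ?_
  have h1 := eLpNorm_smul_le_mul_eLpNorm (p := 2) (q := 2) (r := 1)
    (hu.sub (hφ k)).aestronglyMeasurable hw.aestronglyMeasurable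
  refine le_trans (le_of_eq ?_) h1
  rw [← eLpNorm_neg]
  congr 1
  funext x
  simp only [Pi.neg_apply, Pi.sub_apply, Pi.smul_apply', smul_eq_mul]
  ring

theorem memLp_weakLaplacian {u : Plane → ℝ} {D : Fin 2 → Plane → ℝ}
    {D2 : Fin 2 → Fin 2 → Plane → ℝ} (h : HasH2Derivs u D D2) :
    MemLp (weakLaplacian D2) 2 diskMeasure :=
  memLp_finsetSum Finset.univ fun i _ => h.memLp_second i i

/-- Green's identity between a function of `H² ∩ H¹₀` and a smooth function vanishing on the
circle. -/
theorem integral_mul_weakLaplacian_radialPotential {u : Plane → ℝ} {D : Fin 2 → Plane → ℝ}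
    {D2 : Fin 2 → Fin 2 → Plane → ℝ} {γ : Metric.sphere (0 : Plane) 1 → ℝ}
    (hu : HasH2Derivs u D D2) (h0 : IsH10 u D) (hγ : IsNormalDeriv D D2 γ)
    {a : ℝ → ℝ} (ha : ContDiff ℝ ∞ a) :
    ∫ x in unitDisk, weakLaplacian
        (fun i j => partialDeriv j (partialDeriv i (radialPotential a))) x * u x
      = ∫ x in unitDisk, weakLaplacian D2 x * radialPotential a x := by
  obtain ⟨θ, hθ, hθu, hθD⟩ := h0
  have hφ := radialPotential_contDiff ha
  have hE := hasH2Derivs_of_contDiff hφ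
  -- First integration by parts: the test functions approximating `u` in `H¹` carry the weak
  -- derivative identity over to `u` with no boundary term.
  have key : ∀ i, ∫ x in unitDisk, partialDeriv i (radialPotential a) x * D i x
      = -∫ x in unitDisk, partialDeriv i (partialDeriv i (radialPotential a)) x * u x := fun i => by
    have t1 := tendsto_integral_mul_of_tendsto_eLpNorm_two (hu.memLp_first i)
      (fun k => memLp_disk_of_continuous (partialDeriv_contDiff (hθ k).smooth i).continuous 2)
      (hE.memLp_first i) (hθD i)
    have t2 := tendsto_integral_mul_of_tendsto_eLpNorm_two hu.memLp
      (fun k => memLp_disk_of_continuous (hθ k).smooth.continuous 2)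
      (hE.memLp_second i i) hθu
    refine tendsto_nhds_unique t1 (t2.neg.congr fun k => ?_)
    exact (hE.second i i (θ k) (hθ k)).symm
  have hi1 : ∀ i, Integrable (fun x => D i x * partialDeriv i (radialPotential a) x) diskMeasure :=
    fun i => (hu.memLp_first i).integrable_mul (hE.memLp_first i)
  have hi2 : Integrable (fun x => weakLaplacian D2 x * radialPotential a x) diskMeasure :=
    (memLp_weakLaplacian hu).integrable_mul hE.memLp
  have hi3 : ∀ i, Integrable (fun x => partialDeriv i (partialDeriv i (radialPotential a)) x * u x)
    diskMeasure := fun i => (hE.memLp_second i i).integrable_mul hu.memLp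
  have hg := hγ.green _ hφ
  -- In the second integration by parts the boundary term vanishes because the potential is zero on
  -- the circle.
  have hz : ∫ z, γ z * radialPotential a (z : Plane) ∂circleMeasure = 0 := by
    refine integral_eq_zero_of_ae (Eventually.of_forall fun z => ?_)
    have hz : ‖(z : Plane)‖ = 1 := mem_sphere_zero_iff_norm.1 z.2
    simp [radialPotential, hz]
  rw [hz, integral_add (integrable_finsetSum _ fun i _ => hi1 i) hi2,
    integral_finsetSum _ fun i _ => hi1 i] at hg
  have hs : ∀ i, ∫ x in unitDisk, D i x * partialDeriv i (radialPotential a) x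
      = -∫ x in unitDisk, partialDeriv i (partialDeriv i (radialPotential a)) x * u x := fun i => by
    rw [← key i]
    simp only [mul_comm]
  simp only [hs, Finset.sum_neg_distrib] at hg
  simp only [weakLaplacian, Finset.sum_mul] at hg ⊢
  rw [integral_finsetSum _ fun i _ => hi3 i]
  linarith

/-- The profile density of the radial solution of `Δ v = h`, up to the averaging of `h`. -/
noncomputable def profileDensity (h : Plane → ℝ) (τ : ℝ) : ℝ :=
  -diskCumulative h τ / (4 * Real.pi * τ)

theorem intervalIntegrable_profileDensity {h : Plane → ℝ} (hh : MemLp h 2 diskMeasure) :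
    IntervalIntegrable (profileDensity h) volume 0 1 := by
  obtain ⟨K, hK⟩ := abs_diskCumulative_le hh
  have hM := continuous_diskCumulative (hh.integrable one_le_two)
  have hmeas : Measurable (profileDensity h) :=
    hM.measurable.neg.div (measurable_id.const_mul _)
  have hb : IntervalIntegrable (fun τ : ℝ => K / (4 * Real.pi) * τ ^ (-(1 / 2) : ℝ)) volume 0 1 :=
    (intervalIntegral.intervalIntegrable_rpow' (by norm_num)).const_mul _
  refine hb.mono_fun' hmeas.aestronglyMeasurable ?_
  rw [Set.uIoc_of_le zero_le_one]
  filter_upwards [ae_restrict_mem measurableSet_Ioc] with τ hτ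
  have hτ0 : 0 < τ := hτ.1
  have hs := Real.sqrt_pos.2 hτ0
  have hsq : τ = √τ * √τ := (Real.mul_self_sqrt hτ0.le).symm
  have hden : 0 < 4 * Real.pi * τ := by positivity
  rw [profileDensity, Real.norm_eq_abs, abs_div, abs_neg, abs_of_pos hden, Real.rpow_neg hτ0.le,
    ← Real.sqrt_eq_rpow, div_le_iff₀ hden]
  refine (hK τ hτ).trans (le_of_eq ?_)
  have hπ := Real.pi_pos
  rw [show K / (4 * Real.pi) * (√τ)⁻¹ * (4 * Real.pi * τ) = K * (√τ)⁻¹ * τ by field_simp]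
  conv_rhs => rw [hsq, Real.sqrt_mul_self hs.le]
  field_simp

theorem continuousOn_profile {A : ℝ → ℝ} (hA : IntervalIntegrable A volume 0 1) :
    ContinuousOn (fun s => ∫ τ in s..1, A τ) (Set.Icc 0 1) := by
  have := intervalIntegral.continuousOn_primitive_interval_left (μ := volume) (f := A)
    (a := 0) (b := 1) ((intervalIntegrable_iff' (by simp)).1 hA)
  rwa [Set.uIcc_of_le zero_le_one] at this

/-- A radial function of `H² ∩ H¹₀` is recovered from the fluxes of its gradient. -/
theorem ae_eq_radialPotential_profileDensity {u : Plane → ℝ} {D : Fin 2 → Plane → ℝ}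
    {D2 : Fin 2 → Fin 2 → Plane → ℝ} {γ : Metric.sphere (0 : Plane) 1 → ℝ}
    (hu : HasH2Derivs u D D2) (h0 : IsH10 u D) (hγ : IsNormalDeriv D D2 γ)
    (hrad : IsRadialOnDisk u) :
    ∀ᵐ x ∂diskMeasure, u x = radialPotential (profileDensity (weakLaplacian D2)) x := by
  have hL2 := memLp_weakLaplacian hu
  set L := weakLaplacian D2
  set A := profileDensity L with hAdef
  have hA : IntervalIntegrable A volume 0 1 := intervalIntegrable_profileDensity hL2
  have hLi : Integrable L diskMeasure := hL2.integrable one_le_two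
  obtain ⟨G, hG, hGu⟩ := exists_measurable_radial_profile hu.memLp.aestronglyMeasurable hrad
  set W : ℝ → ℝ := fun s => ∫ τ in s..1, A τ
  have hWc : ContinuousOn W (Set.Icc 0 1) := continuousOn_profile hA
  have hWm : AEStronglyMeasurable W (volume.restrict (Set.Ioc (0 : ℝ) 1)) :=
    (hWc.mono Set.Ioc_subset_Icc_self).aestronglyMeasurable measurableSet_Ioc
  have hWmap : AEStronglyMeasurable W (Measure.map (fun x : Plane => ‖x‖ ^ 2) diskMeasure) := by
    rw [map_norm_sq_diskMeasure]
    exact hWm.smul_measure _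
  obtain ⟨C, hC⟩ := isCompact_Icc.exists_bound_of_continuousOn hWc
  have hVm : AEStronglyMeasurable (radialPotential A) diskMeasure :=
    hWmap.comp_measurable (by fun_prop : Measurable fun x : Plane => ‖x‖ ^ 2)
  have hVi : MemLp (radialPotential A) 2 diskMeasure := by
    refine MemLp.of_bound hVm C ?_
    filter_upwards [ae_restrict_mem Metric.isOpen_ball.measurableSet] with x hx
    exact hC _ (Set.Ico_subset_Icc_self (norm_sq_mem_Ico_of_mem_disk hx))
  set K : ℝ → ℝ := fun s => G s - W s with hKdef
  have hKu : ∀ᵐ x ∂diskMeasure, K (‖x‖ ^ 2) = u x - radialPotential A x := by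
    filter_upwards [hGu] with x hx
    rw [hx]
    rfl
  have hKm : AEStronglyMeasurable K (volume.restrict (Set.Ioc (0 : ℝ) 1)) :=
    hG.aestronglyMeasurable.sub hWm
  have hKi : IntegrableOn K (Set.Ioc (0 : ℝ) 1) := by
    have h1 : Integrable (fun x => u x - radialPotential A x) diskMeasure :=
      (hu.memLp.sub hVi).integrable one_le_two
    have h2 : Integrable K (Measure.map (fun x : Plane => ‖x‖ ^ 2) diskMeasure) :=
      (integrable_map_measure (hG.aestronglyMeasurable.sub hWmap) (by fun_prop)).2
        (h1.congr (hKu.mono fun x hx => hx.symm))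
    rw [map_norm_sq_diskMeasure, integrable_smul_measure (by simp [Real.pi_pos])
      ENNReal.ofReal_ne_top] at h2
    exact h2
  -- The difference of the two profiles is shown to be orthogonal to every test function `ρ` on
  -- `(0,1)`, by pairing both with `ρ(|x|²) = -Δφ`.
  have hK0 : ∀ᵐ s : ℝ, s ∈ Set.Ioo (0 : ℝ) 1 → K s = 0 := by
    refine isOpen_Ioo.ae_eq_zero_of_integral_contDiff_smul_eq_zero
      (hKi.mono_set Set.Ioo_subset_Ioc_self).locallyIntegrableOn fun ρ hρ hρc hρs => ?_
    -- Vanishing of `ρ` near `0` makes its radial average smooth at the origin.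
    obtain ⟨δ, hδ, hδρ⟩ : ∃ δ > 0, ∀ s ≤ δ, ρ s = 0 := by
      have hmem : (tsupport ρ)ᶜ ∈ 𝓝 (0 : ℝ) :=
        (isClosed_tsupport ρ).isOpen_compl.mem_nhds fun h => lt_irrefl _ (hρs h).1
      obtain ⟨ε, hε, hball⟩ := Metric.mem_nhds_iff.1 hmem
      refine ⟨ε / 2, by positivity, fun s hs => image_eq_zero_of_notMem_tsupport fun hmem => ?_⟩
      refine hball ?_ hmem
      rw [Metric.mem_ball, dist_zero_right, Real.norm_of_nonneg (hρs hmem).1.le]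
      linarith
    obtain ⟨a, ha, hav⟩ := exists_contDiff_average hρ hδ hδρ
    have hφ := radialPotential_contDiff ha
    have hρc' : Continuous fun x : Plane => ρ (‖x‖ ^ 2) := hρ.continuous.comp (by fun_prop)
    have hρL := memLp_disk_of_continuous hρc' 2
    have e1 := integral_mul_weakLaplacian_radialPotential hu h0 hγ ha
    simp only [weakLaplacian_radialPotential_of_integral ha hρ.continuous hav, neg_mul,
      integral_neg] at e1
    -- After Fubini on both sides the integrands match pointwise: `ρ(|x|²)` has flux `4πτ a(τ)`, and
    -- `A = -M/(4πτ)`.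
    have e2 : ∫ x in unitDisk, ρ (‖x‖ ^ 2) * radialPotential A x
        = -∫ x in unitDisk, L x * radialPotential a x := by
      rw [integral_mul_radialPotential (hρL.integrable one_le_two) hA,
        integral_mul_radialPotential hLi (ha.continuous.intervalIntegrable _ _),
        ← intervalIntegral.integral_neg, intervalIntegral.integral_of_le zero_le_one,
        intervalIntegral.integral_of_le zero_le_one]
      refine setIntegral_congr_fun measurableSet_Ioc fun τ hτ => ?_
      have hτ0 : τ ≠ 0 := hτ.1.ne'
      have hπ := Real.pi_ne_zero
      rw [diskCumulative_norm_sq hρ.continuous hτ, ← hav τ, hAdef, profileDensity]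
      field_simp
    have e3 : ∫ x in unitDisk, ρ (‖x‖ ^ 2) * K (‖x‖ ^ 2) = 0 := by
      have : ∫ x in unitDisk, ρ (‖x‖ ^ 2) * K (‖x‖ ^ 2) = ∫ x in unitDisk,
          (ρ (‖x‖ ^ 2) * u x - ρ (‖x‖ ^ 2) * radialPotential A x) := by
        refine integral_congr_ae (hKu.mono fun x hx => ?_)
        dsimp only
        rw [hx, mul_sub]
      have hsub := integral_sub (hρL.integrable_mul hu.memLp) (hρL.integrable_mul hVi)
      simp only [Pi.mul_apply] at hsub
      rw [this, hsub, e2]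
      linarith
    rw [integral_disk_norm_sq (F := fun s => ρ s * K s)
      (hρ.continuous.aestronglyMeasurable.mul hKm), mul_eq_zero,
      or_iff_right Real.pi_ne_zero, intervalIntegral.integral_of_le zero_le_one] at e3
    rw [← e3]
    refine (setIntegral_eq_integral_of_forall_compl_eq_zero fun s hs => ?_).symm
    rw [image_eq_zero_of_notMem_tsupport fun h => hs (Set.Ioo_subset_Ioc_self (hρs h)), zero_smul]
  have hK1 : ∀ᵐ s : ℝ, s ∈ Set.Ioc (0 : ℝ) 1 → K s = 0 := by
    have h1 : ∀ᵐ τ : ℝ, τ ≠ 1 := by simp [ae_iff]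
    filter_upwards [hK0, h1] with s hs hs1 hs2
    exact hs ⟨hs2.1, lt_of_le_of_ne hs2.2 hs1⟩
  filter_upwards [ae_disk_norm_sq_of_ae_Ioc hK1, hKu] with x hx hx'
  linarith

/-! ### Sign of the flux -/

/-- A positive flux at `1` would, by continuity, be positive just below `1`. The potential, which is
zero on the circle, would then be negative on an annulus of positive measure. -/
theorem diskCumulative_one_nonpos {h : Plane → ℝ} (hh : Integrable h diskMeasure)
    (hpos : ∀ᵐ x ∂diskMeasure, 0 ≤ radialPotential (profileDensity h) x) :
    diskCumulative h 1 ≤ 0 := by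
  by_contra! hcon
  have hev := (continuous_diskCumulative hh).continuousAt.eventually (eventually_gt_nhds hcon)
  obtain ⟨ε, hε, hball⟩ := Metric.eventually_nhds_iff.1 hev
  -- The maximum with `0` keeps the annulus away from the origin, where the density is singular.
  set δ := max (1 - ε) 0 with hδ
  have hδ1 : δ < 1 := max_lt (by linarith) one_pos
  have hnot : ∀ᵐ x ∂diskMeasure, ‖x‖ ^ 2 ∉ Set.Ioo δ 1 := by
    filter_upwards [hpos] with x hx hmem
    refine hx.not_gt ?_
    have hδx : δ < ‖x‖ ^ 2 := hmem.1
    have hneg : ∀ τ ∈ Set.Icc (‖x‖ ^ 2) 1, profileDensity h τ < 0 := fun τ hτ => by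
      have hτ0 : 0 < τ := (le_max_right _ _).trans_lt (hδx.trans_le hτ.1)
      have hτε : 1 - ε < τ := (le_max_left _ _).trans_lt (hδx.trans_le hτ.1)
      have hM : 0 < diskCumulative h τ := hball (by
        rw [Real.dist_eq, abs_lt]
        constructor <;> linarith [hτ.2])
      exact div_neg_of_neg_of_pos (by linarith) (by positivity)
    have hcont : ContinuousOn (profileDensity h) (Set.Icc (‖x‖ ^ 2) 1) :=
      (continuous_diskCumulative hh).neg.continuousOn.div (by fun_prop) fun τ hτ => by
        have : 0 < τ := (le_max_right _ _).trans_lt (hδx.trans_le hτ.1)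
        positivity
    have := intervalIntegral.intervalIntegral_pos_of_pos_on (a := ‖x‖ ^ 2) (b := 1)
      (f := fun τ => -profileDensity h τ)
      (hcont.neg.intervalIntegrable_of_Icc hmem.2.le)
      (fun τ hτ => neg_pos.2 (hneg τ (Set.Ioo_subset_Icc_self hτ))) hmem.2
    rw [intervalIntegral.integral_neg] at this
    exact neg_pos.1 this
  have h2 := ae_Ioc_of_ae_disk_norm_sq (P := fun s => s ∉ Set.Ioo δ 1)
    measurableSet_Ioo.compl hnot
  rw [ae_restrict_iff' measurableSet_Ioc, ae_iff] at h2
  have h3 : volume (Set.Ioo δ 1) = 0 := by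
    refine measure_mono_null (fun s hs => ?_) h2
    simp only [Set.mem_ofPred_eq, Classical.not_imp, not_not]
    exact ⟨⟨(le_max_right _ _).trans_lt hs.1, hs.2.le⟩, hs⟩
  rw [Real.volume_Ioo, ENNReal.ofReal_eq_zero] at h3
  linarith

/-- A smooth step equal to one on `s ≤ t` and vanishing for `s ≥ t + 1/(n+1)`. -/
noncomputable def smoothStep (t : ℝ) (n : ℕ) (s : ℝ) : ℝ :=
  Real.smoothTransition (1 + (n + 1) * (t - s))

theorem smoothStep_contDiff (t : ℝ) (n : ℕ) : ContDiff ℝ ∞ (smoothStep t n) :=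
  Real.smoothTransition.contDiff.comp (by fun_prop)

theorem smoothStep_eq_one {t : ℝ} (n : ℕ) {s : ℝ} (hs : s ≤ t) : smoothStep t n s = 1 := by
  apply Real.smoothTransition.one_of_one_le
  have : 0 ≤ ((n : ℝ) + 1) * (t - s) := mul_nonneg (by positivity) (by linarith)
  linarith

theorem smoothStep_nonneg (t : ℝ) (n : ℕ) (s : ℝ) : 0 ≤ smoothStep t n s :=
  Real.smoothTransition.nonneg _

theorem tendsto_smoothStep {t s : ℝ} (hs : t < s) :
    Tendsto (fun n => smoothStep t n s) atTop (𝓝 0) := by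
  apply tendsto_const_nhds.congr'
  obtain ⟨N, hN⟩ := exists_nat_ge (1 / (s - t))
  filter_upwards [eventually_ge_atTop N] with n hn
  have hn' : (N : ℝ) ≤ n := by exact_mod_cast hn
  rw [div_le_iff₀ (by linarith)] at hN
  rw [smoothStep, Real.smoothTransition.zero_of_nonpos]
  nlinarith

theorem tendsto_integral_smoothStep {h : Plane → ℝ} (hh : Integrable h diskMeasure) (t : ℝ) :
    Tendsto (fun n => ∫ x in unitDisk, h x * smoothStep t n (‖x‖ ^ 2)) atTop
      (𝓝 (diskCumulative h t)) := by
  refine tendsto_integral_of_dominated_convergence (fun x => ‖h x‖) (fun n => ?_) hh.norm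
    (fun n => Eventually.of_forall fun x => ?_) ?_
  · have : Continuous fun x : Plane => smoothStep t n (‖x‖ ^ 2) :=
      (smoothStep_contDiff t n).continuous.comp (by fun_prop)
    exact hh.aestronglyMeasurable.mul this.aestronglyMeasurable
  · rw [norm_mul, Real.norm_of_nonneg (smoothStep_nonneg _ _ _)]
    exact mul_le_of_le_one_right (norm_nonneg _) (Real.smoothTransition.le_one _)
  · filter_upwards [ae_disk_norm_sq_ne t] with x hx
    rcases lt_or_gt_of_ne hx with hlt | hgt
    · rw [Set.indicator_of_mem (s := {x : Plane | ‖x‖ ^ 2 < t}) hlt]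
      simp [smoothStep_eq_one _ hlt.le]
    · rw [Set.indicator_of_notMem (s := {x : Plane | ‖x‖ ^ 2 < t}) hgt.not_gt]
      simpa using (tendsto_smoothStep hgt).const_mul (h x)

/-- Every smooth step has an average `a` bounded below, uniformly in the step. -/
theorem exists_average_smoothStep {t : ℝ} (ht : t ∈ Set.Ioo (0 : ℝ) 1) (n : ℕ) :
    ∃ a : ℝ → ℝ, ContDiff ℝ ∞ a ∧ (∀ s, 4 * s * a s = ∫ τ in (0 : ℝ)..s, smoothStep t n τ) ∧
      ∀ s ∈ Set.Ioc (0 : ℝ) 1, t / 4 ≤ a s := by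
  obtain ⟨a, ha, hav⟩ := exists_contDiff_average (smoothStep_contDiff t n) ht.1
    (fun s hs => smoothStep_eq_one n hs)
  refine ⟨a, ha, hav, fun s hs => ?_⟩
  have hc := (smoothStep_contDiff t n).continuous
  -- The integral is at least `min s t`, and `min s t ≥ t s` on `(0,1]`; dividing by `4 s` gives the
  -- constant `t / 4`.
  have hlow : t * s ≤ ∫ τ in (0 : ℝ)..s, smoothStep t n τ := by
    rcases le_total s t with hst | hst
    · rw [intervalIntegral.integral_congr (g := fun _ => (1 : ℝ)) fun τ hτ =>
        smoothStep_eq_one n (hτ.2.trans (max_le ht.1.le hst))]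
      simp only [intervalIntegral.integral_const, smul_eq_mul]
      nlinarith [hs.1, ht.2]
    · rw [← intervalIntegral.integral_add_adjacent_intervals (b := t)
        (hc.intervalIntegrable _ _) (hc.intervalIntegrable _ _),
        intervalIntegral.integral_congr (a := 0) (g := fun _ => (1 : ℝ)) fun τ hτ =>
        smoothStep_eq_one n (hτ.2.trans (max_le ht.1.le le_rfl))]
      have := intervalIntegral.integral_nonneg (μ := volume) hst
        fun τ _ => smoothStep_nonneg t n τ
      simp only [intervalIntegral.integral_const, smul_eq_mul]
      nlinarith [hs.2, ht.1]
  rw [← hav s] at hlow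
  nlinarith [hs.1]

theorem le_radialPotential {a : ℝ → ℝ} (ha : Continuous a) {c : ℝ}
    (h : ∀ s ∈ Set.Ioc (0 : ℝ) 1, c ≤ a s) {x : Plane} (hx : x ∈ unitDisk) :
    c * (1 - ‖x‖ ^ 2) ≤ radialPotential a x := by
  have hs := norm_sq_mem_Ico_of_mem_disk hx
  have := intervalIntegral.integral_mono_on_of_le_Ioo (μ := volume) hs.2.le
    (f := fun _ => c) (g := a) intervalIntegrable_const (ha.intervalIntegrable _ _)
    fun s hs' => h s ⟨hs.1.trans_lt hs'.1, hs'.2.le⟩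
  rw [intervalIntegral.integral_const, smul_eq_mul] at this
  rw [radialPotential]
  linarith

theorem integral_normalDeriv {D : Fin 2 → Plane → ℝ} {D2 : Fin 2 → Fin 2 → Plane → ℝ}
    {γ : Metric.sphere (0 : Plane) 1 → ℝ} (hγ : IsNormalDeriv D D2 γ) :
    ∫ z, γ z ∂circleMeasure = ∫ x in unitDisk, weakLaplacian D2 x := by
  have := hγ.green (fun _ => 1) contDiff_const
  simpa [partialDeriv] using this.symm

theorem integral_mul_one_sub_norm_sq_pos {f : Plane → ℝ} (hf : Integrable f diskMeasure)
    (hf0 : ∀ᵐ x ∂diskMeasure, 0 ≤ f x) (hne : ¬ ∀ᵐ x ∂diskMeasure, f x = 0) :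
    0 < ∫ x in unitDisk, f x * (1 - ‖x‖ ^ 2) := by
  have hmem : ∀ᵐ x ∂diskMeasure, x ∈ unitDisk :=
    ae_restrict_mem Metric.isOpen_ball.measurableSet
  have hnn : 0 ≤ᵐ[diskMeasure] fun x => f x * (1 - ‖x‖ ^ 2) := by
    filter_upwards [hf0, hmem] with x hx hxd
    exact mul_nonneg hx (by linarith [(norm_sq_mem_Ico_of_mem_disk hxd).2])
  have hint : Integrable (fun x => f x * (1 - ‖x‖ ^ 2)) diskMeasure := by
    refine hf.mul_bdd (c := 1) (Continuous.aestronglyMeasurable (by fun_prop)) ?_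
    filter_upwards [hmem] with x hxd
    have := norm_sq_mem_Ico_of_mem_disk hxd
    rw [Real.norm_of_nonneg (by linarith [this.2])]
    linarith [this.1]
  refine lt_of_le_of_ne (integral_nonneg_of_ae hnn) fun h0 => hne ?_
  have := (integral_eq_zero_iff_of_nonneg_ae hnn hint).1 h0.symm
  filter_upwards [this, hmem] with x hx hxd
  rcases mul_eq_zero.1 hx with h | h
  · exact h
  · linarith [(norm_sq_mem_Ico_of_mem_disk hxd).2]

/-- The flux of the gradient of a nonnegative solution through every circle is negative. -/
theorem diskCumulative_neg {σ : ℝ} (hσ : σ ≤ 1) {f : Plane → ℝ} {D : Fin 2 → Plane → ℝ}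
    {D2 : Fin 2 → Fin 2 → Plane → ℝ} {γ : Metric.sphere (0 : Plane) 1 → ℝ}
    (hL : Integrable (weakLaplacian D2) diskMeasure) (hγ : IsNormalDeriv D D2 γ)
    (hf : Integrable f diskMeasure) (hf0 : ∀ᵐ x ∂diskMeasure, 0 ≤ f x)
    (hne : ¬ ∀ᵐ x ∂diskMeasure, f x = 0)
    (hweak : ∀ (φ : Plane → ℝ) (E : Fin 2 → Plane → ℝ) (E2 : Fin 2 → Fin 2 → Plane → ℝ)
      (η : Metric.sphere (0 : Plane) 1 → ℝ),
      HasH2Derivs φ E E2 → IsH10 φ E → IsNormalDeriv E E2 η →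
      (∫ x in unitDisk, weakLaplacian D2 x * weakLaplacian E2 x)
          - (1 - σ) * ∫ z, γ z * η z ∂circleMeasure
        = ∫ x in unitDisk, f x * φ x)
    (h1 : diskCumulative (weakLaplacian D2) 1 ≤ 0) {t : ℝ} (ht : t ∈ Set.Ioo (0 : ℝ) 1) :
    diskCumulative (weakLaplacian D2) t < 0 := by
  -- The test potentials dominate `(t/4)(1 - |x|²)` whatever the step, so `κ` is a gap independent
  -- of `n` and the strict inequality survives the limit.
  set κ := ∫ x in unitDisk, f x * (t / 4 * (1 - ‖x‖ ^ 2)) with hκ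
  have hκpos : 0 < κ := by
    have := mul_pos (show 0 < t / 4 by linarith [ht.1])
      (integral_mul_one_sub_norm_sq_pos hf hf0 hne)
    rw [← integral_const_mul] at this
    refine this.trans_eq (integral_congr_ae (Eventually.of_forall fun x => ?_))
    dsimp only
    ring
  have hfc : ∀ φ : Plane → ℝ, Continuous φ → Integrable (fun x => f x * φ x) diskMeasure :=
    fun φ hφ => by
      obtain ⟨C, hC⟩ := (isCompact_closedBall (0 : Plane) 1).exists_bound_of_continuousOn
        hφ.continuousOn
      refine hf.mul_bdd (c := C) hφ.aestronglyMeasurable ?_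
      filter_upwards [ae_restrict_mem Metric.isOpen_ball.measurableSet] with x hx
      exact hC x (Metric.ball_subset_closedBall hx)
  have hbound : ∀ n, ∫ x in unitDisk, weakLaplacian D2 x * smoothStep t n (‖x‖ ^ 2) ≤ -κ :=
    fun n => by
      obtain ⟨a, ha, hav, halow⟩ := exists_average_smoothStep ht n
      have hφ := radialPotential_contDiff ha
      have e := hweak _ _ _ _ (hasH2Derivs_of_contDiff hφ) (isH10_radialPotential ha)
        (isNormalDeriv_radialPotential ha)
      simp only [weakLaplacian_radialPotential_of_integral ha
        (smoothStep_contDiff t n).continuous hav, mul_neg, integral_neg] at e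
      -- The normal derivative of the test function is the constant `-2 a(1)`, so only the mean of
      -- `γ` enters, and it equals the total flux `M(1)`.
      rw [integral_mul_const, integral_normalDeriv hγ] at e
      have hle : κ ≤ ∫ x in unitDisk, f x * radialPotential a x := by
        refine integral_mono_ae (hfc _ (by fun_prop)) (hfc _ hφ.continuous) ?_
        filter_upwards [hf0, ae_restrict_mem Metric.isOpen_ball.measurableSet] with x hx hxd
        exact mul_le_mul_of_nonneg_left (le_radialPotential ha.continuous halow hxd) hx
      have ha1 : 0 ≤ a 1 := (show 0 ≤ t / 4 by linarith [ht.1]).trans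
        (halow 1 ⟨one_pos, le_rfl⟩)
      -- With `σ ≤ 1`, `a(1) ≥ 0` and `M(1) ≤ 0`, the boundary term has the favourable sign and can
      -- be dropped.
      have hbd : 0 ≤ (1 - σ) * (a 1 * -diskCumulative (weakLaplacian D2) 1) :=
        mul_nonneg (by linarith) (mul_nonneg ha1 (by linarith))
      rw [diskCumulative_one] at hbd
      linarith
  exact (le_of_tendsto' (tendsto_integral_smoothStep hL t) hbound).trans_lt (by linarith)

/-! ### Strict monotonicity and conclusion -/

theorem strictAntiOn_profile {A : ℝ → ℝ} (hA : IntervalIntegrable A volume 0 1)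
    (hpos : ∀ τ ∈ Set.Ioo (0 : ℝ) 1, 0 < A τ) :
    StrictAntiOn (fun s => ∫ τ in s..1, A τ) (Set.Icc 0 1) := by
  intro s hs t ht hst
  have hint : ∀ r ∈ Set.Icc (0 : ℝ) 1, ∀ r' ∈ Set.Icc (0 : ℝ) 1, IntervalIntegrable A volume r r' :=
    fun r hr r' hr' => hA.mono_set (by
      rw [Set.uIcc_of_le zero_le_one]
      exact Set.uIcc_subset_Icc hr hr')
  have h1 : (1 : ℝ) ∈ Set.Icc (0 : ℝ) 1 := by simp
  dsimp only
  rw [← intervalIntegral.integral_add_adjacent_intervals (hint s hs t ht) (hint t ht 1 h1)]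
  have := intervalIntegral.intervalIntegral_pos_of_pos_on (hint s hs t ht)
    (fun τ hτ => hpos τ ⟨hs.1.trans_lt hτ.1, hτ.2.trans_le ht.2⟩) hst
  linarith

theorem proposition7p3 (σ p : ℝ) (q : ℝ≥0∞) (g u : Plane → ℝ)
    (hσ : σ ∈ Set.Ioc (-1 : ℝ) 1)
    (hp : p ∈ Set.Ioo (0 : ℝ) 1 ∪ Set.Ioi 1)
    (hq : 2 < q)
    (hg : MemLp g q diskMeasure)
    (hg_radial : IsRadialOnDisk g)
    (hg_pos : ∀ᵐ x ∂diskMeasure, 0 < g x)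
    (hu : IsWeakSteklovSolution σ p g u)
    (hu_radial : IsRadialOnDisk u)
    (hu_nonneg : ∀ᵐ x ∂diskMeasure, 0 ≤ u x)
    (hu_nontrivial : ¬ ∀ᵐ x ∂diskMeasure, u x = 0) :
    ∃ U : ℝ → ℝ, ContinuousOn U (Set.Icc 0 1) ∧
      (∀ᵐ x ∂diskMeasure, u x = U ‖x‖) ∧
      StrictAntiOn U (Set.Icc 0 1) ∧
      ∀ r ∈ Set.Ico (0 : ℝ) 1, 0 < U r := by
  obtain ⟨D, D2, γ, hH2, hH10, hγ, hweak⟩ := hu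
  have hp0 : 0 < p := hp.elim (fun h => h.1) fun h => one_pos.trans h
  have hL2 := memLp_weakLaplacian hH2
  have hL := hL2.integrable one_le_two
  have hA := intervalIntegrable_profileDensity hL2
  have huV := ae_eq_radialPotential_profileDensity hH2 hH10 hγ hu_radial
  set A := profileDensity (weakLaplacian D2) with hAdef
  have hcont := continuousOn_profile hA
  have h1 : diskCumulative (weakLaplacian D2) 1 ≤ 0 := by
    refine diskCumulative_one_nonpos hL ?_
    filter_upwards [huV, hu_nonneg] with x hx hx0
    rwa [← hAdef, ← hx]
  obtain ⟨C, hC⟩ := isCompact_Icc.exists_bound_of_continuousOn hcont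
  have huC : ∀ᵐ x ∂diskMeasure, |u x| ≤ C := by
    filter_upwards [huV, ae_restrict_mem Metric.isOpen_ball.measurableSet] with x hx hxd
    rw [hx]
    exact hC _ (Set.Ico_subset_Icc_self (norm_sq_mem_Ico_of_mem_disk hxd))
  have hum := hH2.memLp.aestronglyMeasurable.aemeasurable
  have hgi : Integrable g diskMeasure := hg.integrable (one_le_two.trans hq.le)
  have hpow : ∀ {y : ℝ}, y ≠ 0 → |(|y| ^ (p - 1) * y)| = |y| ^ p := fun {y} hy => by
    have hy' : 0 < |y| := abs_pos.2 hy
    rw [abs_mul, abs_of_nonneg (Real.rpow_nonneg hy'.le _), Real.rpow_sub_one hy'.ne']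
    field_simp
  -- For `p < 1` the factor `|u|^(p-1)` is unbounded near zeros of `u`, so it is kept together with
  -- `u`: the product is bounded by `C^p`, as `u` agrees a.e. with a bounded profile.
  have hfi : Integrable (fun x => g x * |u x| ^ (p - 1) * u x) diskMeasure := by
    have hm : AEMeasurable (fun x => |u x| ^ (p - 1) * u x) diskMeasure :=
      ((measurable_abs.comp_aemeasurable hum).pow_const _).mul hum
    refine (hgi.mul_bdd (c := C ^ p) hm.aestronglyMeasurable ?_).congr
      (Eventually.of_forall fun x => (mul_assoc _ _ _).symm)
    filter_upwards [huC] with x hx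
    rw [Real.norm_eq_abs]
    by_cases h0 : u x = 0
    · rw [h0, mul_zero, abs_zero]
      exact Real.rpow_nonneg ((abs_nonneg _).trans hx) _
    · rw [hpow h0]
      exact Real.rpow_le_rpow (abs_nonneg _) hx hp0.le
  have hneg : ∀ τ ∈ Set.Ioo (0 : ℝ) 1, diskCumulative (weakLaplacian D2) τ < 0 := fun τ hτ => by
    refine diskCumulative_neg hσ.2 hL hγ hfi ?_ ?_ hweak h1 hτ
    · filter_upwards [hg_pos, hu_nonneg] with x hgx hux
      have := Real.rpow_nonneg (abs_nonneg (u x)) (p - 1)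
      positivity
    · refine fun hz => hu_nontrivial ?_
      filter_upwards [hg_pos, hz] with x hgx hx
      by_contra h0
      have := Real.rpow_pos_of_pos (abs_pos.2 h0) (p - 1)
      exact mul_ne_zero (mul_pos hgx this).ne' h0 hx
  have hApos : ∀ τ ∈ Set.Ioo (0 : ℝ) 1, 0 < A τ := fun τ hτ => by
    have hτ0 : 0 < τ := hτ.1
    exact div_pos (by linarith [hneg τ hτ]) (by positivity)
  have hanti := strictAntiOn_profile hA hApos
  have hmaps : Set.MapsTo (fun r : ℝ => r ^ 2) (Set.Icc 0 1) (Set.Icc 0 1) := fun r hr =>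
    ⟨sq_nonneg r, pow_le_one₀ hr.1 hr.2⟩
  have hUanti : StrictAntiOn (fun r : ℝ => ∫ τ in (r ^ 2)..1, A τ) (Set.Icc 0 1) :=
    fun r hr t ht hrt => hanti (hmaps hr) (hmaps ht) (pow_lt_pow_left₀ hrt hr.1 two_ne_zero)
  refine ⟨fun r => ∫ τ in (r ^ 2)..1, A τ, hcont.comp (by fun_prop) hmaps, huV, hUanti,
    fun r hr => ?_⟩
  -- Positivity follows from strict decrease and the value `0` at `r = 1`.
  have := hUanti (Set.Ico_subset_Icc_self hr) (Set.right_mem_Icc.2 zero_le_one) hr.2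
  simpa using this
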